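/- Let $(V,\rho)$ be a metric space. For distinct points $a,b,c\in V$ write $[abc]$ if $\rho(a,c)=\rho(a,b)+\rho(b,c)$. For distinct $a,b\in V$, the line $\overline{ab}$ generated by $a$ and $b$ is the set consisting of $a$, $b$ and all points $c\in V\setminus\{a,b\}$ such that $[acb]$, $[abc]$ or $[bac]$. The lines of $(V,\rho)$ are the sets $\overline{ab}$ with $a\neq b$, counted as distinct sets. The metric space induced by a finite connected graph is its vertex set with $\rho(u,v)$ the number of edges of a shortest path from $u$ to $v$. Theorem. Any metric space induced by a connected graph on $n$ vertices with diameter at most $D$ (where $D\ge 1$ is an integer) has at least $(2^{-7/3}-o(1))\,(n/D)^{4/3}$ distinct lines as $n/D\to\infty$. That is, for every $\varepsilon>0$ there is $K=K(\varepsilon)$ such that, for all integers $n\ge 0$ and $D\ge 1$ with $n/D\ge K$, every metric space induced by a connected graph on $n$ vertices with diameter at most $D$ has at least $(2^{-7/3}-\varepsilon)(n/D)^{4/3}$ distinct lines. -/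

import Mathlib

/-- In a metric space, `b` lies between `a` and `c` (written `[abc]`): the three points are
distinct and `ρ(a, c) = ρ(a, b) + ρ(b, c)`. -/
def MetricBetween {V : Type*} [MetricSpace V] (a b c : V) : Prop :=
  a ≠ b ∧ b ≠ c ∧ a ≠ c ∧ dist a c = dist a b + dist b c

/-- The line generated by `a` and `b`: the points `a`, `b` and all points `c` with
`[acb]`, `[abc]` or `[bac]`. -/
def metricLine {V : Type*} [MetricSpace V] (a b : V) : Set V :=
  {a, b} ∪ {c | MetricBetween a c b ∨ MetricBetween a b c ∨ MetricBetween b a c}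

/-- The set of all lines of a metric space (each line generated by two distinct points). -/
def metricLines (V : Type*) [MetricSpace V] : Set (Set V) :=
  {L | ∃ a b : V, a ≠ b ∧ L = metricLine a b}

/-- The metric of `V` is the one induced by the connected graph `G` on the vertex set `V`:
the distance of two vertices is the least number of edges of a walk joining them. -/
def IsInducedByGraph (V : Type*) [MetricSpace V] (G : SimpleGraph V) : Prop :=
  G.Connected ∧ ∀ u v : V, dist u v = (G.dist u v : ℝ)

/-! Let N be the number of lines. The core is `IsInducedByGraph.card_le`: if N ≤ Y^4 with Y ≥ 100,
then n ≤ 3.36 D Y^3. Since 3.36 < 2^(7/4), this gives the constant 2^(-7/3). The recurring principle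
is that k suitably positioned pairs generating one common line force k(k-1)/2 different lines, so k
is at most about √(2N).

Pairs at distance i ≥ 2. Fix a line, a distance i and a base pair (x₀, y₀). Every other pair
generating that line either points away from x₀ or y₀, or has both strictly between its ends.
Sorting the pairs by this alternative and by the distance from the base point to the nearer end
leaves at most 2D classes. Pairs pointing away from a common root are legs of a spider, and no three
of their far ends are collinear (`card_spider`). Pairs around the base points are diagonals of
rectangles and form an antipodal family (`card_antipodal`). Hence there are at most about 2√2 D² Y^6
long pairs.

Adjacent pairs. If few pairs are long, some vertex has degree linear in n, and its neighbourhood S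
has pairwise distances at most 2. The points of S without twins are few, because any line is
generated by few pairs of them (`card_twinless`). For points with twins, nonadjacent pairs almost
determine their lines, so such pairs are few (`card_nonadjacent_of_twins`); counting coincidences of
lines then bounds the adjacent pairs by the nonadjacent ones (`sq_card_adjacent_le`). Together |S| ≤
4.3 Y^3. -/

section LineCounting

open Finset

/-! ### Lines in terms of graph distances -/

section GraphMetric

variable {V : Type*} [MetricSpace V] {G : SimpleGraph V}

theorem IsInducedByGraph.triangle (h : IsInducedByGraph V G) (a b c : V) :
    G.dist a c ≤ G.dist a b + G.dist b c :=
  h.1.dist_triangle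

theorem IsInducedByGraph.dist_eq_zero (h : IsInducedByGraph V G) {a b : V} :
    G.dist a b = 0 ↔ a = b :=
  h.1.dist_eq_zero_iff

theorem IsInducedByGraph.pos_of_ne (h : IsInducedByGraph V G) {a b : V} (hab : a ≠ b) :
    0 < G.dist a b :=
  h.1.pos_dist_of_ne hab

/-- Membership in a line, in terms of graph distances; the degenerate cases `c = a` and `c = b`
are covered by the first alternative. -/
theorem IsInducedByGraph.mem_line (h : IsInducedByGraph V G) {a b : V} (hab : a ≠ b) (c : V) :
    c ∈ metricLine a b ↔
      G.dist a c + G.dist c b = G.dist a b ∨ G.dist a b + G.dist b c = G.dist a c ∨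
        G.dist b a + G.dist a c = G.dist b c := by
  have hd : ∀ u v w x y z : V,
      dist u v = dist w x + dist y z ↔ G.dist w x + G.dist y z = G.dist u v := by
    intro u v w x y z
    rw [h.2, h.2, h.2]
    norm_cast
    exact eq_comm
  by_cases hca : c = a
  · subst hca
    simp [metricLine]
  by_cases hcb : c = b
  · subst hcb
    simp [metricLine]
  simp only [metricLine, MetricBetween, Set.mem_union, Set.mem_insert_iff, Set.mem_singleton_iff,
    Set.mem_ofPred_eq, hca, hcb, hd, false_or]
  have h1 : a ≠ c := Ne.symm hca
  have h2 : b ≠ c := Ne.symm hcb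
  simp [hab, hab.symm, hcb, h1, h2]

theorem IsInducedByGraph.exists_between (h : IsInducedByGraph V G) {u v : V} {s t : ℕ}
    (huv : G.dist u v = s + t) : ∃ z, G.dist u z = s ∧ G.dist z v = t := by
  obtain ⟨p, hp⟩ := h.1.exists_walk_length_eq_dist u v
  refine ⟨p.getVert s, ?_⟩
  have h1 := SimpleGraph.dist_le (p.take s)
  have h2 := SimpleGraph.dist_le (p.drop s)
  have h3 := h.triangle u (p.getVert s) v
  rw [SimpleGraph.Walk.take_length] at h1
  rw [SimpleGraph.Walk.drop_length] at h2
  omega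

theorem metricLine_mem_metricLines {a b : V} (hab : a ≠ b) : metricLine a b ∈ metricLines V :=
  ⟨a, b, hab, rfl⟩

end GraphMetric

/-! ### Lower bounds for the number of lines -/

section Counting

variable {V : Type*} [MetricSpace V] [Fintype V]

theorem metricLines_finite (V : Type*) [MetricSpace V] [Fintype V] : (metricLines V).Finite :=
  Set.toFinite _

/-- A family of lines in which every line occurs at most `k` times has at most
`k` times as many members as there are lines. -/
theorem card_le_mul_ncard_metricLines {ι : Type*} (s : Finset ι) (f : ι → Set V) (k : ℕ)
    (hf : ∀ e ∈ s, f e ∈ metricLines V)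
    (hk : ∀ t ⊆ s, (∀ e ∈ t, ∀ e' ∈ t, f e = f e') → t.card ≤ k) :
    s.card ≤ k * (metricLines V).ncard := by
  classical
  rw [Set.ncard_eq_toFinset_card _ (metricLines_finite V)]
  refine card_le_mul_card_image_of_maps_to (f := f) (fun e he => by simpa using hf e he) k ?_
  intro L _
  refine hk _ (filter_subset _ _) ?_
  intro e he e' he'
  rw [(mem_filter.1 he).2, (mem_filter.1 he').2]

/-- If lines `M j l` are attached to pairs of indices so that different pairs get different
lines, then there are at least as many lines as pairs. -/
theorem card_mul_pred_le_of_injective {ι : Type*} (J : Finset ι) (M : ι → ι → Set V)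
    (hM : ∀ j ∈ J, ∀ l ∈ J, j ≠ l → M j l ∈ metricLines V)
    (hinj : ∀ j ∈ J, ∀ l ∈ J, ∀ j' ∈ J, ∀ l' ∈ J, j ≠ l → j' ≠ l' → M j l = M j' l' →
      (j' = j ∨ j' = l) ∧ (l' = j ∨ l' = l)) :
    J.card * (J.card - 1) ≤ 2 * (metricLines V).ncard := by
  classical
  have h1 : J.offDiag.card = J.card * (J.card - 1) := by
    rw [offDiag_card, Nat.mul_sub_one]
  rw [← h1]
  refine card_le_mul_ncard_metricLines _ (fun e => M e.1 e.2) 2 ?_ ?_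
  · rintro ⟨j, l⟩ he
    simp only [mem_offDiag] at he
    exact hM j he.1 l he.2.1 he.2.2
  · intro t ht hte
    rcases t.eq_empty_or_nonempty with rfl | ⟨⟨j, l⟩, he⟩
    · simp
    refine (card_le_card (t := {(j, l), (l, j)}) ?_).trans card_le_two
    rintro ⟨j', l'⟩ he'
    have m := mem_offDiag.1 (ht he)
    have m' := mem_offDiag.1 (ht he')
    obtain ⟨a, b⟩ := hinj j m.1 l m.2.1 j' m'.1 l' m'.2.1 m.2.2 m'.2.2 (hte _ he _ he')
    have := m'.2.2
    rcases a with rfl | rfl <;> rcases b with rfl | rfl <;> simp_all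

/-- If the line attached to a pair of indices determines the pair, because those two are the only
indices incident with it, then there are at least as many lines as pairs. -/
theorem card_mul_pred_le_of_incidence {ι : Type*} (J : Finset ι) (M : ι → ι → Set V)
    (inc : ι → Set V → Prop)
    (hM : ∀ j ∈ J, ∀ l ∈ J, j ≠ l → M j l ∈ metricLines V)
    (hl : ∀ j ∈ J, ∀ l ∈ J, j ≠ l → inc j (M j l) ∧ inc l (M j l))
    (hm : ∀ j ∈ J, ∀ l ∈ J, j ≠ l → ∀ m ∈ J, m ≠ j → m ≠ l → ¬ inc m (M j l)) :
    J.card * (J.card - 1) ≤ 2 * (metricLines V).ncard := by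
  refine card_mul_pred_le_of_injective J M hM ?_
  intro j hj l hl' j' hj' l' hl'' hne hne' he
  have := hl j' hj' l' hl'' hne'
  rw [← he] at this
  constructor
  · by_contra hcon
    push Not at hcon
    exact hm j hj l hl' hne j' hj' hcon.1 hcon.2 this.1
  · by_contra hcon
    push Not at hcon
    exact hm j hj l hl' hne l' hl'' hcon.1 hcon.2 this.2

/-- Points no three of which are collinear generate pairwise distinct lines. -/
theorem card_mul_pred_le_of_noncollinear {ι : Type*} (J : Finset ι) (y : ι → V)
    (hy : ∀ j ∈ J, ∀ l ∈ J, j ≠ l → y j ≠ y l)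
    (hm : ∀ j ∈ J, ∀ l ∈ J, ∀ m ∈ J, j ≠ l → m ≠ j → m ≠ l → y m ∉ metricLine (y j) (y l)) :
    J.card * (J.card - 1) ≤ 2 * (metricLines V).ncard := by
  refine card_mul_pred_le_of_incidence J (fun j l => metricLine (y j) (y l)) (fun m L => y m ∈ L)
    (fun j hj l hl h => metricLine_mem_metricLines (hy j hj l hl h)) ?_ ?_
  · intro j _ l _ _
    simp [metricLine]
  · intro j hj l hl h m hm' h1 h2
    exact hm j hj l hl m hm' h h1 h2

end Counting

/-! ### Rectangles and spiders -/

section LongPairs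

theorem ne_of_dist_pos {V : Type*} {G : SimpleGraph V} {a b : V} (hab : 0 < G.dist a b) :
    a ≠ b := by
  rintro rfl
  simp at hab

variable {V : Type*} [MetricSpace V] {G : SimpleGraph V}

/-- Opposite sides of a rectangle generate different lines unless they are edges. -/
theorem IsInducedByGraph.not_parallel (h : IsInducedByGraph V G) {a b a' b' : V} {i t : ℕ}
    (hi : 2 ≤ i) (ht : 0 < t) (hab : G.dist a b = i) (hab' : G.dist a' b' = i)
    (haa : G.dist a a' = t) (hbb : G.dist b b' = t) (hx : G.dist a b' = t + i)
    (hy : G.dist a' b = t + i) : metricLine a b ≠ metricLine a' b' := by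
  intro hL
  -- The neighbour of `a` towards `b` has distances t + 1 and t + i - 1 to `a'` and `b'`, so it is
  -- off their line when i ≥ 2.
  obtain ⟨z, hz1, hz2⟩ := h.exists_between (u := a) (v := b) (s := 1) (t := i - 1) (by omega)
  have hne : a ≠ b := ne_of_dist_pos (G := G) (by omega)
  have hne' : a' ≠ b' := ne_of_dist_pos (G := G) (by omega)
  have hz : z ∈ metricLine a' b' := by
    rw [← hL, h.mem_line hne]
    omega
  rw [h.mem_line hne'] at hz
  have t1 := h.triangle a' a z
  have t2 := h.triangle a' z b
  have t3 := h.triangle b' b z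
  have t4 := h.triangle a z b'
  have c1 := G.dist_comm (u := a) (v := a')
  have c2 := G.dist_comm (u := b) (v := b')
  have c3 := G.dist_comm (u := b) (v := z)
  have c4 := G.dist_comm (u := b') (v := z)
  have c5 := G.dist_comm (u := b') (v := a')
  omega

/-- Moving from the root along a geodesic towards the near endpoint of one pair, one stays behind
the near endpoint of every other pair that generates the same line and is as far away. -/
theorem IsInducedByGraph.behind_of_root (h : IsInducedByGraph V G) {r a b a' b' : V} {i : ℕ}
    (hi : 2 ≤ i) (hab : G.dist a b = i) (hab' : G.dist a' b' = i)
    (hL : metricLine a b = metricLine a' b') (hr : G.dist r b = G.dist r a + i)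
    (hr' : G.dist r b' = G.dist r a' + i) (hp : G.dist r a = G.dist r a') :
    G.dist a' b = G.dist a' a + i := by
  have hne : a ≠ b := ne_of_dist_pos (G := G) (by omega)
  have hne' : a' ≠ b' := ne_of_dist_pos (G := G) (by omega)
  -- Every point of the walk lies on the common line, while one step changes d(z,b) - d(z,a) by at
  -- most 2. As d(z,b) ≥ i throughout, z cannot leave the position behind `a`.
  have walk : ∀ s z, G.dist r z = s → G.dist r z + G.dist z a' = G.dist r a' →
      G.dist z b = G.dist z a + i := by
    intro s
    induction s with
    | zero =>
      intro z hz _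
      rw [h.dist_eq_zero] at hz
      rw [← hz, hr]
    | succ s ih =>
      intro z hz hza
      obtain ⟨w, hw1, hw2⟩ := h.exists_between (u := r) (v := z) hz
      have t1 := h.triangle r w a'
      have t2 := h.triangle w z a'
      have hw := ih w hw1 (by omega)
      have hz' : z ∈ metricLine a b := by
        rw [hL, h.mem_line hne']
        have t3 := h.triangle r z b'
        have t4 := h.triangle z a' b'
        have c1 := G.dist_comm (u := a') (v := z)
        have c2 := G.dist_comm (u := b') (v := z)
        have c3 := G.dist_comm (u := a') (v := b')
        omega
      rw [h.mem_line hne] at hz'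
      have t3 := h.triangle r z b
      have t4 := h.triangle z w a
      have t5 := h.triangle w z b
      have c1 := G.dist_comm (u := a) (v := z)
      have c2 := G.dist_comm (u := b) (v := z)
      have c3 := G.dist_comm (u := a) (v := b)
      have c4 := G.dist_comm (u := w) (v := z)
      omega
  exact walk _ a' rfl (by simp)

/-- Two pairs that generate the same line and are attached to the root in the same way are
legs of a spider. -/
theorem IsInducedByGraph.spider (h : IsInducedByGraph V G) {r a b a' b' : V} {i : ℕ}
    (hi : 2 ≤ i) (hab : G.dist a b = i) (hab' : G.dist a' b' = i)
    (hL : metricLine a b = metricLine a' b') (hr : G.dist r b = G.dist r a + i)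
    (hr' : G.dist r b' = G.dist r a' + i) (hp : G.dist r a = G.dist r a') :
    (a = a' ∧ b = b') ∨ G.dist b b' = G.dist a a' + 2 * i := by
  have hne : a ≠ b := ne_of_dist_pos (G := G) (by omega)
  have h1 := h.behind_of_root hi hab hab' hL hr hr' hp
  have h2 := h.behind_of_root hi hab' hab hL.symm hr' hr hp.symm
  have hb' : b' ∈ metricLine a b := by
    rw [hL]
    simp [metricLine]
  rw [h.mem_line hne] at hb'
  have c1 := G.dist_comm (u := a) (v := a')
  have c2 := G.dist_comm (u := a) (v := b)
  rcases Nat.eq_zero_or_pos (G.dist a a') with h0 | h0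
  · have e := h.dist_eq_zero.1 h0
    by_cases hbb : G.dist b b' = 0
    · exact Or.inl ⟨e, h.dist_eq_zero.1 hbb⟩
    · right
      subst e
      have c3 := G.dist_comm (u := b) (v := b')
      omega
  · right
    by_contra hcon
    refine h.not_parallel (t := G.dist a a') hi h0 hab hab' rfl ?_ (by omega) (by omega) hL
    omega

variable [Fintype V]

/-- The distance between two far ends is that of the near ends plus 2i. By the triangle inequality
for near ends, a sum of two such distances exceeds the third by at least 2i, so no three far ends
are collinear. -/
theorem IsInducedByGraph.card_spider (h : IsInducedByGraph V G) {ι : Type*} (J : Finset ι)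
    (a b : ι → V) (r : V) {i p : ℕ} {L : Set V} (hi : 2 ≤ i)
    (hab : ∀ j ∈ J, G.dist (a j) (b j) = i) (hL : ∀ j ∈ J, metricLine (a j) (b j) = L)
    (hp : ∀ j ∈ J, G.dist r (a j) = p) (hr : ∀ j ∈ J, G.dist r (b j) = p + i)
    (hinj : ∀ j ∈ J, ∀ l ∈ J, a j = a l → b j = b l → j = l) :
    J.card * (J.card - 1) ≤ 2 * (metricLines V).ncard := by
  have key : ∀ j ∈ J, ∀ l ∈ J, j ≠ l →
      G.dist (b j) (b l) = G.dist (a j) (a l) + 2 * i := by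
    intro j hj l hl hne
    have h1 := hp j hj
    have h2 := hp l hl
    have h3 := hr j hj
    have h4 := hr l hl
    rcases h.spider (r := r) hi (hab j hj) (hab l hl) ((hL j hj).trans (hL l hl).symm)
      (by omega) (by omega) (by omega) with ⟨e1, e2⟩ | e
    · exact absurd (hinj j hj l hl e1 e2) hne
    · exact e
  have hne : ∀ j ∈ J, ∀ l ∈ J, j ≠ l → b j ≠ b l := fun j hj l hl hne =>
    ne_of_dist_pos (G := G) (by have := key j hj l hl hne; omega)
  refine card_mul_pred_le_of_noncollinear J b hne ?_
  intro j hj l hl m hm hjl hmj hml hmem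
  rw [h.mem_line (hne j hj l hl hjl)] at hmem
  have k1 := key j hj l hl hjl
  have k2 := key j hj m hm hmj.symm
  have k3 := key m hm l hl hml
  have c1 := G.dist_comm (u := b l) (v := b j)
  have c2 := G.dist_comm (u := b l) (v := b m)
  have c3 := G.dist_comm (u := a l) (v := a m)
  have c4 := G.dist_comm (u := a m) (v := a j)
  have c5 := G.dist_comm (u := a l) (v := a j)
  have t1 := h.triangle (a j) (a m) (a l)
  have t2 := h.triangle (a j) (a l) (a m)
  have t3 := h.triangle (a l) (a j) (a m)
  omega

end LongPairs

/-! ### Antipodal families -/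

section Antipodal

variable {V : Type*} [MetricSpace V] {G : SimpleGraph V}

theorem IsInducedByGraph.metricLine_comm (h : IsInducedByGraph V G) (a b : V) :
    metricLine a b = metricLine b a := by
  rcases eq_or_ne a b with rfl | hab
  · rfl
  ext c
  rw [h.mem_line hab, h.mem_line hab.symm, G.dist_comm (u := a) (v := c),
    G.dist_comm (u := c) (v := b), G.dist_comm (u := a) (v := b)]
  omega

/-- A point strictly between the antipodes `u'`, `v'` of `u`, `v` is not on the line `uv`. -/
theorem IsInducedByGraph.not_mem_line_of_between_antipodes (h : IsInducedByGraph V G)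
    {u v u' v' z : V} {i P c : ℕ} (hu : G.dist u u' = i) (huv : G.dist u v = P) (hc : 0 < c)
    (hcP : c < P) (hPi : P < i) (hv' : G.dist u v' = i - P) (hvu' : G.dist v u' = i - P)
    (hvv : G.dist v v' = i) (hz : G.dist u' z = c) (hz' : G.dist z v' = P - c) :
    G.dist u z = i - c ∧ G.dist v z = i - P + c ∧ z ∉ metricLine u v := by
  have t1 := h.triangle u z u'
  have t2 := h.triangle u v' z
  have t3 := h.triangle v z v'
  have t4 := h.triangle v u' z
  have c1 := G.dist_comm (u := z) (v := u')
  have c2 := G.dist_comm (u := z) (v := v')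
  have c3 := G.dist_comm (u := z) (v := v)
  have c4 := G.dist_comm (u := v) (v := u)
  have e1 : G.dist u z = i - c := by omega
  have e2 : G.dist v z = i - P + c := by omega
  refine ⟨e1, e2, ?_⟩
  rw [h.mem_line (ne_of_dist_pos (G := G) (by omega))]
  omega

variable {Ω : Type*} {f : Ω → V} {σ : Ω → Ω} {i : ℕ}

/-- In an antipodal family, the lines through two points contain the antipodes of these points. -/
theorem IsInducedByGraph.antipode_mem_line (h : IsInducedByGraph V G)
    (A : ∀ u v, G.dist (f u) (f v) + G.dist (f (σ u)) (f v) = i) {u v : Ω} (huv : f u ≠ f v) :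
    f (σ u) ∈ metricLine (f u) (f v) ∧ f (σ v) ∈ metricLine (f u) (f v) := by
  rw [h.mem_line huv, h.mem_line huv]
  have h1 := A u v
  have h2 := A v u
  have h3 := A u u
  have h4 := A v v
  simp only [SimpleGraph.dist_self, zero_add] at h3 h4
  have c1 := G.dist_comm (u := f u) (v := f v)
  have c2 := G.dist_comm (u := f u) (v := f (σ u))
  have c3 := G.dist_comm (u := f v) (v := f (σ v))
  have c4 := G.dist_comm (u := f v) (v := f (σ u))
  have c5 := G.dist_comm (u := f u) (v := f (σ v))
  omega

/-- A point that lies, together with its antipode, on a line through two points of the family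
is not strictly between these points. -/
theorem IsInducedByGraph.outside_of_antipodal (h : IsInducedByGraph V G)
    (A : ∀ u v, G.dist (f u) (f v) + G.dist (f (σ u)) (f v) = i) {u v x : Ω}
    (huv : f u ≠ f v) (hi : G.dist (f u) (f v) < i) (hx : f x ∈ metricLine (f u) (f v))
    (hx' : f (σ x) ∈ metricLine (f u) (f v)) :
    G.dist (f x) (f u) = G.dist (f x) (f v) + G.dist (f u) (f v) ∨
      G.dist (f x) (f v) = G.dist (f x) (f u) + G.dist (f u) (f v) := by
  rw [h.mem_line huv] at hx hx'
  have h1 := A x u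
  have h2 := A x v
  have c1 := G.dist_comm (u := f u) (v := f v)
  have c2 := G.dist_comm (u := f u) (v := f x)
  have c3 := G.dist_comm (u := f v) (v := f x)
  have c4 := G.dist_comm (u := f v) (v := f (σ x))
  have c5 := G.dist_comm (u := f u) (v := f (σ x))
  omega

/-- The witness is the neighbour of `f (σ u)` towards `f (σ v)`. For points beyond `f v`, the
distances to it and to `f u` have constant sum; hence it lies on the line of any two such points
that are aligned with `f u` and have `f u` outside. -/
theorem IsInducedByGraph.exists_not_mem_line_of_antipodal (h : IsInducedByGraph V G)
    (A : ∀ u v, G.dist (f u) (f v) + G.dist (f (σ u)) (f v) = i) {u v : Ω}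
    (huv : 2 ≤ G.dist (f u) (f v)) (huv' : G.dist (f u) (f v) < i) :
    ∃ z, z ∉ metricLine (f u) (f v) ∧ ∀ w,
      G.dist (f w) (f u) = G.dist (f w) (f v) + G.dist (f u) (f v) →
        G.dist (f w) z + G.dist (f w) (f u) = i + 1 := by
  have a1 := A u u
  have a2 := A v v
  have a3 := A u v
  have a4 := A v u
  have a7 := A u (σ v)
  simp only [SimpleGraph.dist_self, zero_add] at a1 a2
  have b1 := G.dist_comm (u := f u) (v := f (σ u))
  have b2 := G.dist_comm (u := f v) (v := f (σ v))
  have b3 := G.dist_comm (u := f u) (v := f (σ v))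
  have b4 := G.dist_comm (u := f v) (v := f (σ u))
  have b5 := G.dist_comm (u := f v) (v := f u)
  obtain ⟨z, hz, hz'⟩ := h.exists_between (u := f (σ u)) (v := f (σ v)) (s := 1)
    (t := G.dist (f u) (f v) - 1) (by omega)
  obtain ⟨e1, e2, e3⟩ := h.not_mem_line_of_between_antipodes (c := 1) (i := i) (by omega) rfl
    (by omega) (by omega) huv' (by omega) (by omega) (by omega) hz hz'
  refine ⟨z, e3, fun w hw => ?_⟩
  have a5 := A u w
  have b6 := G.dist_comm (u := f u) (v := f w)
  have b7 := G.dist_comm (u := f w) (v := f (σ u))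
  have b8 := G.dist_comm (u := f v) (v := f w)
  have t1 := h.triangle (f w) (f (σ u)) z
  have t3 := h.triangle (f v) (f w) z
  clear a1 a2 a3 a4 a7 b1 b2 b3 b4
  omega

/-- If the lines agreed, `outside_of_antipodal` would apply in both directions. With `f s` also
beyond `f v`, the point `z` above lies on one line only. With `f s` beyond `f u`, the four points
form a rectangle with opposite sides uv and sw, which `not_parallel` excludes. -/
theorem IsInducedByGraph.antipodal_lines_ne_of_beyond (h : IsInducedByGraph V G)
    (A : ∀ u v, G.dist (f u) (f v) + G.dist (f (σ u)) (f v) = i) {u v w s : Ω}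
    (huv : 2 ≤ G.dist (f u) (f v)) (huv' : G.dist (f u) (f v) < i) (hws : f w ≠ f s)
    (hws' : G.dist (f w) (f s) < i) (hwv : f w ≠ f v)
    (hw : G.dist (f w) (f u) = G.dist (f w) (f v) + G.dist (f u) (f v)) :
    metricLine (f u) (f v) ≠ metricLine (f w) (f s) := by
  intro hM
  have hne : f u ≠ f v := ne_of_dist_pos (G := G) (by omega)
  obtain ⟨m1, m2⟩ := h.antipode_mem_line A hne
  obtain ⟨m3, m4⟩ := h.antipode_mem_line A hws
  have hs := h.outside_of_antipodal A hne huv' (x := s) (by rw [hM]; simp [metricLine])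
    (by rw [hM]; exact m4)
  have hu := h.outside_of_antipodal A hws hws' (x := u) (by rw [← hM]; simp [metricLine])
    (by rw [← hM]; exact m1)
  have hv := h.outside_of_antipodal A hws hws' (x := v) (by rw [← hM]; simp [metricLine])
    (by rw [← hM]; exact m2)
  have c1 := G.dist_comm (u := f u) (v := f w)
  have c2 := G.dist_comm (u := f v) (v := f w)
  have c3 := G.dist_comm (u := f u) (v := f s)
  have c4 := G.dist_comm (u := f v) (v := f s)
  have c5 := G.dist_comm (u := f w) (v := f s)
  have c6 := G.dist_comm (u := f u) (v := f v)
  have pos := h.pos_of_ne hwv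
  rcases hs with hs | hs
  · obtain ⟨z, hz1, hz2⟩ := h.exists_not_mem_line_of_antipodal A huv huv'
    have hwz := hz2 w hw
    have hsz := hz2 s hs
    apply hz1
    rw [hM, h.mem_line hws]
    have b1 := G.dist_comm (u := f s) (v := z)
    clear m1 m2 m3 m4 hv hz2 hz1 hM A
    omega
  · refine h.not_parallel (a := f u) (b := f v) (a' := f s) (b' := f w) huv pos rfl ?_ ?_ ?_ ?_ ?_
      (hM.trans (h.metricLine_comm _ _)) <;> omega

theorem IsInducedByGraph.antipodal_lines_ne (h : IsInducedByGraph V G)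
    (A : ∀ u v, G.dist (f u) (f v) + G.dist (f (σ u)) (f v) = i) {u v w s : Ω}
    (huv : 2 ≤ G.dist (f u) (f v)) (huv' : G.dist (f u) (f v) < i) (hws : f w ≠ f s)
    (hws' : G.dist (f w) (f s) < i) (hwu : f w ≠ f u) (hwv : f w ≠ f v) :
    metricLine (f u) (f v) ≠ metricLine (f w) (f s) := by
  intro hM
  have hne : f u ≠ f v := ne_of_dist_pos (G := G) (by omega)
  obtain ⟨m3, m4⟩ := h.antipode_mem_line A hws
  have c1 := G.dist_comm (u := f u) (v := f v)
  rcases h.outside_of_antipodal A hne huv' (x := w) (by rw [hM]; simp [metricLine])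
    (by rw [hM]; exact m3) with hw | hw
  · exact h.antipodal_lines_ne_of_beyond A huv huv' hws hws' hwv hw hM
  · exact h.antipodal_lines_ne_of_beyond A (by omega) (by omega) hws hws' hwu (by omega)
      ((h.metricLine_comm _ _).trans hM)

variable [Fintype V]

/-- An antipodal family of `k` pairs provides at least `k.choose 2` lines. -/
theorem IsInducedByGraph.card_antipodal (h : IsInducedByGraph V G) {ι : Type*} [Fintype ι]
    (x : ι → Bool → V) (hi : 2 ≤ i)
    (A : ∀ j s l t, G.dist (x j s) (x l t) + G.dist (x j (!s)) (x l t) = i)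
    (hx : ∀ j s l t, j ≠ l → x j s ≠ x l t) :
    Fintype.card ι * (Fintype.card ι - 1) ≤ 2 * (metricLines V).ncard := by
  classical
  have pos : ∀ j s l t, j ≠ l → 0 < G.dist (x j s) (x l t) := fun j s l t hjl =>
    h.pos_of_ne (hx j s l t hjl)
  have lt : ∀ j s l t, j ≠ l → G.dist (x j s) (x l t) < i := by
    intro j s l t hjl
    have h1 := A j s l t
    have h2 := pos j (!s) l t hjl
    omega
  -- For i = 2 all distances between different antipodal pairs are 1, so one point from each pair
  -- gives an equilateral set.
  rcases eq_or_lt_of_le hi with h2 | h3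
  · refine card_mul_pred_le_of_noncollinear univ (fun j => x j true)
      (fun j _ l _ hne => hx j _ l _ hne) ?_
    intro j _ l _ m _ hjl hmj hml
    rw [h.mem_line (hx j _ l _ hjl)]
    have p1 := pos j true l true hjl
    have p2 := pos j true m true hmj.symm
    have p3 := pos m true l true hml
    have q1 := lt j true l true hjl
    have q2 := lt j true m true hmj.symm
    have q3 := lt m true l true hml
    have c1 := G.dist_comm (u := x l true) (v := x j true)
    have c2 := G.dist_comm (u := x l true) (v := x m true)
    omega
  -- The distances from the two points of pair j to `x l true` sum to i ≥ 3, so one of them is at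
  -- least 2, as `antipodal_lines_ne` requires.
  · let t : ι → ι → Bool := fun j l => decide (2 ≤ G.dist (x j true) (x l true))
    have ht : ∀ j l, 2 ≤ G.dist (x j (t j l)) (x l true) := by
      intro j l
      by_cases hjl : 2 ≤ G.dist (x j true) (x l true)
      · simp [t, hjl]
      · have := A j true l true
        simp only [t, hjl, decide_false]
        simp only [Bool.not_true] at this
        omega
    rw [← Finset.card_univ]
    have main : ∀ j l j' l' : ι, j ≠ l → j' ≠ l' → ∀ a b,
        j' ≠ j → j' ≠ l → 
        metricLine (x j (t j l)) (x l true) ≠ metricLine (x j' a) (x l' b) := by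
      intro j l j' l' hjl hjl' a b hj hl
      exact h.antipodal_lines_ne (f := fun p : ι × Bool => x p.1 p.2) (σ := fun p => (p.1, !p.2))
        (u := (j, t j l)) (v := (l, true)) (w := (j', a)) (s := (l', b))
        (fun u v => A u.1 u.2 v.1 v.2) (ht j l) (lt _ _ _ _ hjl) (hx _ _ _ _ hjl')
        (lt _ _ _ _ hjl') (hx _ _ _ _ hj) (hx _ _ _ _ hl)
    refine card_mul_pred_le_of_injective univ (fun j l => metricLine (x j (t j l)) (x l true))
      (fun j _ l _ hjl => metricLine_mem_metricLines (hx _ _ _ _ hjl)) ?_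
    intro j _ l _ j' _ l' _ hjl hjl' he
    constructor
    · by_contra hcon
      push Not at hcon
      exact main j l j' l' hjl hjl' _ _ hcon.1 hcon.2 he
    · by_contra hcon
      push Not at hcon
      exact main j l l' j' hjl hjl'.symm _ _ hcon.1 hcon.2
        (he.trans (h.metricLine_comm _ _))

end Antipodal

/-! ### Ordering the ends of a pair by distance from a root -/

section Ends

variable {V : Type*} {G : SimpleGraph V}

/-- The endpoint of a pair that is nearer to the root `r`. -/
noncomputable def nearEnd (G : SimpleGraph V) (r : V) (e : V × V) : V :=
  if G.dist r e.1 ≤ G.dist r e.2 then e.1 else e.2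

/-- The endpoint of a pair that is farther from the root `r`. -/
noncomputable def farEnd (G : SimpleGraph V) (r : V) (e : V × V) : V :=
  if G.dist r e.1 ≤ G.dist r e.2 then e.2 else e.1

theorem ends_cases (G : SimpleGraph V) (r : V) (e : V × V) :
    (nearEnd G r e = e.1 ∧ farEnd G r e = e.2 ∧ G.dist r e.1 ≤ G.dist r e.2) ∨
      (nearEnd G r e = e.2 ∧ farEnd G r e = e.1 ∧ G.dist r e.2 < G.dist r e.1) := by
  unfold nearEnd farEnd
  split_ifs with h
  · exact Or.inl ⟨rfl, rfl, h⟩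
  · exact Or.inr ⟨rfl, rfl, by omega⟩

theorem eq_or_swap_of_ends {r : V} {e e' : V × V} (h1 : nearEnd G r e = nearEnd G r e')
    (h2 : farEnd G r e = farEnd G r e') : e' = e ∨ e' = (e.2, e.1) := by
  obtain ⟨a, b⟩ := e
  obtain ⟨a', b'⟩ := e'
  rcases ends_cases G r (a, b) with ⟨h3, h4, _⟩ | ⟨h3, h4, _⟩ <;>
    rcases ends_cases G r (a', b') with ⟨h5, h6, _⟩ | ⟨h5, h6, _⟩ <;> simp_all

theorem eq_or_swap_of_ends_swapped {r : V} {e e' : V × V} (h1 : nearEnd G r e = farEnd G r e')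
    (h2 : farEnd G r e = nearEnd G r e') : e' = e ∨ e' = (e.2, e.1) := by
  obtain ⟨a, b⟩ := e
  obtain ⟨a', b'⟩ := e'
  rcases ends_cases G r (a, b) with ⟨h3, h4, _⟩ | ⟨h3, h4, _⟩ <;>
    rcases ends_cases G r (a', b') with ⟨h5, h6, _⟩ | ⟨h5, h6, _⟩ <;> simp_all

end Ends

/-! ### Pairs at distance at least two on a common line -/

section SameLine

variable {V : Type*} [MetricSpace V] {G : SimpleGraph V}

theorem IsInducedByGraph.line_ends (h : IsInducedByGraph V G) (r : V) (e : V × V) :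
    metricLine (nearEnd G r e) (farEnd G r e) = metricLine e.1 e.2 ∧
      G.dist (nearEnd G r e) (farEnd G r e) = G.dist e.1 e.2 := by
  rcases ends_cases G r e with ⟨h1, h2, _⟩ | ⟨h1, h2, _⟩
  · rw [h1, h2]
    exact ⟨rfl, rfl⟩
  · rw [h1, h2]
    exact ⟨h.metricLine_comm _ _, G.dist_comm⟩

/-- Two different pairs that both have `x₀` and `y₀` strictly inside, in the same position, and
generate the same line, are the diagonals of a rectangle. -/
theorem IsInducedByGraph.diagonals (h : IsInducedByGraph V G) {x₀ y₀ a b a' b' : V} {i q : ℕ}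
    (hi : 0 < i) (hab : G.dist a b = i) (hab' : G.dist a' b' = i)
    (hL : metricLine a b = metricLine a' b') (hq : 2 * q ≤ i)
    (h1 : G.dist x₀ a = q) (h2 : G.dist x₀ b = i - q) (h3 : G.dist y₀ a = i - q)
    (h4 : G.dist y₀ b = q) (h1' : G.dist x₀ a' = q) (h2' : G.dist x₀ b' = i - q)
    (h3' : G.dist y₀ a' = i - q) (h4' : G.dist y₀ b' = q) :
    G.dist a a' + G.dist b a' = i ∧ G.dist a b' + G.dist b b' = i ∧
      G.dist a a' + G.dist a b' = i ∧ G.dist b a' + G.dist b b' = i := by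
  have hne : a ≠ b := ne_of_dist_pos (G := G) (by omega)
  have hne' : a' ≠ b' := ne_of_dist_pos (G := G) (by omega)
  have t1 := h.triangle a x₀ a'
  have t2 := h.triangle b y₀ b'
  have t3 := h.triangle a x₀ b'
  have t4 := h.triangle b x₀ a'
  rw [G.dist_comm (u := a) (v := x₀)] at t1 t3
  rw [G.dist_comm (u := b) (v := x₀)] at t4
  rw [G.dist_comm (u := b) (v := y₀)] at t2
  have c1 := G.dist_comm (u := a) (v := a')
  have c2 := G.dist_comm (u := a) (v := b')
  have c3 := G.dist_comm (u := b) (v := a')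
  have c4 := G.dist_comm (u := b) (v := b')
  have c5 := G.dist_comm (u := a) (v := b)
  have c6 := G.dist_comm (u := a') (v := b')
  have m1 : a' ∈ metricLine a b := by rw [hL]; simp [metricLine]
  have m2 : b' ∈ metricLine a b := by rw [hL]; simp [metricLine]
  have m3 : a ∈ metricLine a' b' := by rw [← hL]; simp [metricLine]
  have m4 : b ∈ metricLine a' b' := by rw [← hL]; simp [metricLine]
  rw [h.mem_line hne] at m1 m2
  rw [h.mem_line hne'] at m3 m4
  -- Triangles through `x₀` and `y₀` bound all four cross distances by i. Collinearity with a pair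
  -- of length i then forces the two distances to its ends to sum to i.
  have u1 : G.dist a a' ≤ i := by omega
  have u2 : G.dist b b' ≤ i := by omega
  have u3 : G.dist a b' ≤ i := by omega
  have u4 : G.dist b a' ≤ i := by omega
  clear t1 t2 t3 t4 h1 h2 h3 h4 h1' h2' h3' h4' hq
  refine ⟨?_, ?_, ?_, ?_⟩
  · clear m2 m3 m4
    omega
  · clear m1 m3 m4
    omega
  · clear m1 m2 m4
    omega
  · clear m1 m2 m3
    omega

variable [Fintype V]

theorem IsInducedByGraph.card_outside (h : IsInducedByGraph V G) {E J : Finset (V × V)} {i p : ℕ}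
    {L : Set V} (hi : 2 ≤ i) (hJE : J ⊆ E) (hE : ∀ e ∈ E, G.dist e.1 e.2 = i)
    (hL : ∀ e ∈ E, metricLine e.1 e.2 = L) (hor : ∀ e ∈ E, (e.2, e.1) ∉ E) (r : V)
    (hJ : ∀ e ∈ J, G.dist r (nearEnd G r e) = p)
    (hJ' : ∀ e ∈ J, G.dist r (farEnd G r e) = G.dist r (nearEnd G r e) + i) :
    J.card * (J.card - 1) ≤ 2 * (metricLines V).ncard := by
  refine h.card_spider J (nearEnd G r) (farEnd G r) r (p := p) (L := L) hi ?_ ?_ hJ ?_ ?_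
  · intro e he
    rw [(h.line_ends r e).2, hE e (hJE he)]
  · intro e he
    rw [(h.line_ends r e).1, hL e (hJE he)]
  · intro e he
    rw [hJ' e he, hJ e he]
  · intro e he e' he' h1 h2
    rcases eq_or_swap_of_ends h1 h2 with h3 | h3
    · exact h3.symm
    · exact absurd (h3 ▸ hJE he') (hor e (hJE he))

/-- The ends of each pair lie on the line of `x₀` and `y₀`, which fixes their distances to `y₀` too.
Thus `diagonals` applies to any two pairs and yields the antipodal relation, the two ends of a pair
being antipodes. -/
theorem IsInducedByGraph.card_inside (h : IsInducedByGraph V G) {E J : Finset (V × V)} {i q : ℕ}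
    {L : Set V} (hi : 2 ≤ i) (hJE : J ⊆ E) (hE : ∀ e ∈ E, G.dist e.1 e.2 = i)
    (hL : ∀ e ∈ E, metricLine e.1 e.2 = L) (hor : ∀ e ∈ E, (e.2, e.1) ∉ E) {x₀ y₀ : V}
    (h₀ : (x₀, y₀) ∈ E) (hq : 0 < q) (hJ : ∀ e ∈ J, G.dist x₀ (nearEnd G x₀ e) = q)
    (hx : ∀ e ∈ J, G.dist x₀ e.1 + G.dist x₀ e.2 = i)
    (hy : ∀ e ∈ J, G.dist y₀ e.1 + G.dist y₀ e.2 = i) :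
    J.card * (J.card - 1) ≤ 2 * (metricLines V).ncard := by
  have hd₀ := hE _ h₀
  have hL₀ := hL _ h₀
  simp only at hd₀ hL₀
  have hne₀ : x₀ ≠ y₀ := ne_of_dist_pos (G := G) (by omega)
  have pos : ∀ e ∈ J, 2 * q ≤ i ∧ G.dist x₀ (nearEnd G x₀ e) = q ∧
      G.dist x₀ (farEnd G x₀ e) = i - q ∧ G.dist y₀ (nearEnd G x₀ e) = i - q ∧
      G.dist y₀ (farEnd G x₀ e) = q := by
    intro e he
    have e1 := hJ e he
    have e2 := hx e he
    have e3 := hy e he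
    have m1 : e.1 ∈ metricLine x₀ y₀ := by
      rw [hL₀, ← hL e (hJE he)]
      simp [metricLine]
    have m2 : e.2 ∈ metricLine x₀ y₀ := by
      rw [hL₀, ← hL e (hJE he)]
      simp [metricLine]
    rw [h.mem_line hne₀] at m1 m2
    have c1 := G.dist_comm (u := x₀) (v := y₀)
    have c2 := G.dist_comm (u := y₀) (v := e.1)
    have c3 := G.dist_comm (u := y₀) (v := e.2)
    rcases ends_cases G x₀ e with ⟨h1, h2, h3⟩ | ⟨h1, h2, h3⟩ <;> rw [h1] at e1 <;> rw [h1, h2] <;>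
      refine ⟨by omega, by omega, by omega, by omega, by omega⟩
  have dg : ∀ e ∈ J, ∀ e' ∈ J, _ := fun e he e' he' =>
    h.diagonals (x₀ := x₀) (y₀ := y₀) (a := nearEnd G x₀ e) (b := farEnd G x₀ e)
      (a' := nearEnd G x₀ e') (b' := farEnd G x₀ e') (i := i) (q := q) (by omega)
      ((h.line_ends x₀ e).2.trans (hE e (hJE he))) ((h.line_ends x₀ e').2.trans (hE e' (hJE he')))
      ((h.line_ends x₀ e).1.trans ((hL e (hJE he)).trans
        ((hL e' (hJE he')).symm.trans (h.line_ends x₀ e').1.symm)))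
      (pos e he).1 (pos e he).2.1 (pos e he).2.2.1 (pos e he).2.2.2.1 (pos e he).2.2.2.2
      (pos e' he').2.1 (pos e' he').2.2.1 (pos e' he').2.2.2.1 (pos e' he').2.2.2.2
  have sw : ∀ e ∈ J, ∀ e' ∈ J, e ≠ e' → ¬ (e' = e ∨ e' = (e.2, e.1)) := by
    rintro e he e' he' hne (h1 | h1)
    · exact hne h1.symm
    · exact hor e (hJE he) (h1 ▸ hJE he')
  rw [← Fintype.card_coe]
  refine h.card_antipodal (ι := J) (i := i)
    (fun e s => if s then nearEnd G x₀ e.1 else farEnd G x₀ e.1) hi ?_ ?_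
  · rintro ⟨e, he⟩ s ⟨e', he'⟩ t
    obtain ⟨d1, d2, d3, d4⟩ := dg e he e' he'
    cases s <;> cases t <;> simp <;> omega
  · rintro ⟨e, he⟩ s ⟨e', he'⟩ t hne
    have hne' : e ≠ e' := fun h => hne (Subtype.ext h)
    have hsw := sw e he e' he' hne'
    obtain ⟨d1, d2, d3, d4⟩ := dg e he e' he'
    have z1 := h.dist_eq_zero (a := nearEnd G x₀ e) (b := nearEnd G x₀ e')
    have z2 := h.dist_eq_zero (a := nearEnd G x₀ e) (b := farEnd G x₀ e')
    have z3 := h.dist_eq_zero (a := farEnd G x₀ e) (b := nearEnd G x₀ e')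
    have z4 := h.dist_eq_zero (a := farEnd G x₀ e) (b := farEnd G x₀ e')
    have n1 : ¬ (nearEnd G x₀ e = nearEnd G x₀ e' ∧ farEnd G x₀ e = farEnd G x₀ e') :=
      fun hh => hsw (eq_or_swap_of_ends hh.1 hh.2)
    have n2 : ¬ (nearEnd G x₀ e = farEnd G x₀ e' ∧ farEnd G x₀ e = nearEnd G x₀ e') :=
      fun hh => hsw (eq_or_swap_of_ends_swapped hh.1 hh.2)
    rw [← z1, ← z4] at n1
    rw [← z2, ← z3] at n2
    cases s <;> cases t <;> simp <;> first | rw [← z1] | rw [← z2] | rw [← z3] | rw [← z4]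
    all_goals omega

/-- At a fixed distance `i ≥ 2`, a line is generated by few pairs. -/
theorem IsInducedByGraph.card_pairs_same_line (h : IsInducedByGraph V G) {E : Finset (V × V)}
    {i D κ : ℕ} {L : Set V} (hi : 2 ≤ i) (hD : ∀ u v, G.dist u v ≤ D)
    (hκ : ∀ k : ℕ, k * (k - 1) ≤ 2 * (metricLines V).ncard → k ≤ κ)
    (hE : ∀ e ∈ E, G.dist e.1 e.2 = i) (hL : ∀ e ∈ E, metricLine e.1 e.2 = L)
    (hor : ∀ e ∈ E, (e.2, e.1) ∉ E) : E.card ≤ κ * (2 * D) := by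
  classical
  rcases E.eq_empty_or_nonempty with rfl | ⟨⟨x₀, y₀⟩, h₀⟩
  · simp
  have hd₀ := hE _ h₀
  simp only at hd₀
  have hiD : i ≤ D := hd₀ ▸ hD x₀ y₀
  let out : V → V × V → Prop := fun r e => G.dist r (farEnd G r e) = G.dist r (nearEnd G r e) + i
  -- Colours 0 and 1 are the spider classes rooted at `x₀` and `y₀`; colour 2 has both points
  -- strictly inside. The number of classes is at most 2(D - i + 1) + (i - 1) ≤ 2D.
  let col : V × V → ℕ × ℕ := fun e =>
    if out x₀ e then (0, G.dist x₀ (nearEnd G x₀ e))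
    else if out y₀ e then (1, G.dist y₀ (nearEnd G y₀ e))
    else (2, G.dist x₀ (nearEnd G x₀ e))
  let T : Finset (ℕ × ℕ) := ({0} ×ˢ range (D - i + 1) ∪ {1} ×ˢ range (D - i + 1)) ∪ {2} ×ˢ Ico 1 i
  have hT : T.card ≤ 2 * D := by
    refine (card_union_le _ _).trans ?_
    have := card_union_le (({0} : Finset ℕ) ×ˢ range (D - i + 1)) ({1} ×ˢ range (D - i + 1))
    simp only [card_product, card_singleton, card_range, Nat.card_Ico, one_mul] at this ⊢
    omega
  have inside : ∀ r e, e ∈ E → ¬ out r e →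
      G.dist r e.1 + G.dist r e.2 = i ∧ 0 < G.dist r (nearEnd G r e) ∧
        G.dist r (nearEnd G r e) < i ∨ r ∉ L := by
    intro r e he hout
    by_cases hr : r ∈ L
    · left
      have hde := hE e he
      rw [← hL e he, h.mem_line (ne_of_dist_pos (G := G) (by omega))] at hr
      have c1 := G.dist_comm (u := r) (v := e.1)
      have c2 := G.dist_comm (u := r) (v := e.2)
      have c3 := G.dist_comm (u := e.2) (v := e.1)
      simp only [out] at hout
      rcases ends_cases G r e with ⟨h1, h2, h3⟩ | ⟨h1, h2, h3⟩ <;> rw [h1, h2] at hout <;>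
        rw [h1] <;> omega
    · exact Or.inr hr
  have hx₀ : x₀ ∈ L := by
    rw [← hL _ h₀]
    simp [metricLine]
  have hy₀ : y₀ ∈ L := by
    rw [← hL _ h₀]
    simp [metricLine]
  have hmap : ∀ e ∈ E, col e ∈ T := by
    intro e he
    simp only [col]
    split_ifs with h1 h2
    · simp only [out] at h1
      have := hD x₀ (farEnd G x₀ e)
      simp only [T, mem_union, mem_product, mem_singleton, mem_range]
      left
      left
      exact ⟨trivial, by omega⟩
    · simp only [out] at h2
      have := hD y₀ (farEnd G y₀ e)
      simp only [T, mem_union, mem_product, mem_singleton, mem_range]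
      left
      right
      exact ⟨trivial, by omega⟩
    · rcases inside x₀ e he h1 with h3 | h3
      · simp only [T, mem_union, mem_product, mem_singleton, mem_Ico]
        right
        exact ⟨trivial, h3.2.1, h3.2.2⟩
      · exact absurd hx₀ h3
  refine (card_le_mul_card_image_of_maps_to hmap κ ?_).trans (Nat.mul_le_mul_left κ hT)
  rintro ⟨c, p⟩ hc
  apply hκ
  have hsub : {e ∈ E | col e = (c, p)} ⊆ E := filter_subset _ _
  have colE : ∀ e ∈ {e ∈ E | col e = (c, p)}, col e = (c, p) := fun e he => (mem_filter.1 he).2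
  rcases Nat.lt_or_ge c 1 with h0 | h0
  · obtain rfl : c = 0 := by omega
    have aux : ∀ e ∈ {e ∈ E | col e = (0, p)}, out x₀ e ∧ G.dist x₀ (nearEnd G x₀ e) = p := by
      intro e he
      have := colE e he
      simp only [col] at this
      split_ifs at this with h1 h2
      · exact ⟨h1, by simpa using this⟩
      all_goals simp at this
    exact h.card_outside hi hsub hE hL hor x₀ (fun e he => (aux e he).2) (fun e he => (aux e he).1)
  rcases Nat.lt_or_ge c 2 with h1 | h1
  · obtain rfl : c = 1 := by omega
    have aux : ∀ e ∈ {e ∈ E | col e = (1, p)}, out y₀ e ∧ G.dist y₀ (nearEnd G y₀ e) = p := by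
      intro e he
      have := colE e he
      simp only [col] at this
      split_ifs at this with h1 h2
      · simp at this
      · exact ⟨h2, by simpa using this⟩
      · simp at this
    exact h.card_outside hi hsub hE hL hor y₀ (fun e he => (aux e he).2) (fun e he => (aux e he).1)
  · have hc' : c = 2 ∧ 1 ≤ p := by
      simp only [T, mem_union, mem_product, mem_singleton, mem_range, mem_Ico] at hc
      omega
    obtain ⟨rfl, hp⟩ := hc'
    have aux : ∀ e ∈ {e ∈ E | col e = (2, p)},
        ¬ out x₀ e ∧ ¬ out y₀ e ∧ G.dist x₀ (nearEnd G x₀ e) = p := by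
      intro e he
      have := colE e he
      simp only [col] at this
      split_ifs at this with h1 h2
      · simp at this
      · simp at this
      · exact ⟨h1, h2, by simpa using this⟩
    refine h.card_inside hi hsub hE hL hor h₀ hp (fun e he => (aux e he).2.2) ?_ ?_
    · intro e he
      exact ((inside x₀ e (hsub he) (aux e he).1).resolve_right (fun hn => hn hx₀)).1
    · intro e he
      exact ((inside y₀ e (hsub he) (aux e he).2.1).resolve_right (fun hn => hn hy₀)).1

/-- There are few pairs at distance at least two, relative to the number of lines. -/
theorem IsInducedByGraph.card_long_pairs (h : IsInducedByGraph V G) {E : Finset (V × V)}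
    {D κ : ℕ} (hD : ∀ u v, G.dist u v ≤ D)
    (hκ : ∀ k : ℕ, k * (k - 1) ≤ 2 * (metricLines V).ncard → k ≤ κ)
    (hE : ∀ e ∈ E, 2 ≤ G.dist e.1 e.2) (hor : ∀ e ∈ E, (e.2, e.1) ∉ E) :
    E.card ≤ D * (κ * (2 * D) * (metricLines V).ncard) := by
  classical
  have hmap : ∀ e ∈ E, G.dist e.1 e.2 ∈ Icc 1 D := fun e he => by
    have := hE e he
    have := hD e.1 e.2
    rw [mem_Icc]
    omega
  refine (card_le_mul_card_image_of_maps_to hmap (κ * (2 * D) * (metricLines V).ncard) ?_).trans ?_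
  · intro i _
    refine card_le_mul_ncard_metricLines _ (fun e => metricLine e.1 e.2) _ ?_ ?_
    · intro e he
      have := hE e (filter_subset _ _ he)
      exact metricLine_mem_metricLines (ne_of_dist_pos (G := G) (by omega))
    · intro t ht hte
      rcases t.eq_empty_or_nonempty with rfl | ⟨e₀, he₀⟩
      · simp
      have h₀ := hE e₀ (filter_subset _ _ (ht he₀))
      have hi : ∀ e ∈ t, G.dist e.1 e.2 = i := fun e he => (mem_filter.1 (ht he)).2
      refine h.card_pairs_same_line (i := i) (L := metricLine e₀.1 e₀.2) ?_ hD hκ hi ?_ ?_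
      · have := hi e₀ he₀
        omega
      · exact fun e he => hte e he e₀ he₀
      · exact fun e he he' => hor e (filter_subset _ _ (ht he)) (filter_subset _ _ (ht he'))
  · rw [Nat.card_Icc, Nat.mul_comm]
    simp

end SameLine

/-! ### Counting coincidences of values -/

section Coincidences

variable {α β γ : Type*} [DecidableEq γ]

theorem card_coincidences (A : Finset α) (B : Finset β) (f : α → γ) (g : β → γ) (T : Finset γ)
    (hf : ∀ a ∈ A, f a ∈ T) :
    {p ∈ A ×ˢ B | f p.1 = g p.2}.card =
      ∑ t ∈ T, {a ∈ A | f a = t}.card * {b ∈ B | g b = t}.card := by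
  rw [card_eq_sum_card_fiberwise (f := fun p => f p.1) (t := T)]
  · refine sum_congr rfl fun t _ => ?_
    rw [← card_product]
    congr 1
    ext ⟨a, b⟩
    simp only [mem_filter, mem_product]
    constructor
    · rintro ⟨⟨⟨h1, h2⟩, h3⟩, h4⟩
      exact ⟨⟨h1, h4⟩, h2, by rw [← h3, h4]⟩
    · rintro ⟨⟨h1, h2⟩, h3, h4⟩
      exact ⟨⟨⟨h1, h3⟩, by rw [h2, h4]⟩, h2⟩
  · intro p hp
    simp only [coe_filter, mem_product, Set.mem_ofPred_eq] at hp
    exact hf _ hp.1.1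

/-- Cauchy–Schwarz over the fibre sizes. -/
theorem sq_card_le_mul_card_coincidences (A : Finset α) (f : α → γ) (T : Finset γ)
    (hf : ∀ a ∈ A, f a ∈ T) :
    A.card ^ 2 ≤ T.card * {p ∈ A ×ˢ A | f p.1 = f p.2}.card := by
  rw [card_coincidences A A f f T hf, card_eq_sum_card_fiberwise (f := f) (t := T) hf]
  simp only [← sq]
  exact sq_sum_le_card_mul_sum_sq

/-- Apply 2xy ≤ x² + y² to the fibre sizes of `f` and `g` over each value. -/
theorem card_coincidences_le (A : Finset α) (B : Finset β) (f : α → γ) (g : β → γ) (T : Finset γ)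
    (hf : ∀ a ∈ A, f a ∈ T) (hg : ∀ b ∈ B, g b ∈ T) {q : ℕ}
    (hA : {p ∈ A ×ˢ A | f p.1 = f p.2}.card ≤ q) (hB : {p ∈ B ×ˢ B | g p.1 = g p.2}.card ≤ q) :
    {p ∈ A ×ˢ B | f p.1 = g p.2}.card ≤ q := by
  rw [card_coincidences _ _ f f T hf] at hA
  rw [card_coincidences _ _ g g T hg] at hB
  rw [card_coincidences _ _ f g T hf]
  have : 2 * ∑ t ∈ T, {a ∈ A | f a = t}.card * {b ∈ B | g b = t}.card ≤
      ∑ t ∈ T, {a ∈ A | f a = t}.card * {a ∈ A | f a = t}.card +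
        ∑ t ∈ T, {b ∈ B | g b = t}.card * {b ∈ B | g b = t}.card := by
    rw [← sum_add_distrib, mul_sum]
    refine sum_le_sum fun t _ => ?_
    have := two_mul_le_add_sq {a ∈ A | f a = t}.card {b ∈ B | g b = t}.card
    nlinarith
  omega

end Coincidences

/-! ### Unordered pairs as ordered pairs -/

section OrientedPairs

variable {V : Type*} [Fintype V]

/-- The pairs of distinct elements of `U`, each in one order only. -/
noncomputable def orientedPairs (U : Finset V) : Finset (V × V) :=
  {e ∈ U ×ˢ U | Fintype.equivFin V e.1 < Fintype.equivFin V e.2}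

theorem mem_orientedPairs {U : Finset V} {e : V × V} :
    e ∈ orientedPairs U ↔ (e.1 ∈ U ∧ e.2 ∈ U) ∧ Fintype.equivFin V e.1 < Fintype.equivFin V e.2 := by
  simp [orientedPairs]

theorem ne_of_mem_orientedPairs {U : Finset V} {e : V × V} (he : e ∈ orientedPairs U) :
    e.1 ≠ e.2 := by
  intro h
  have := (mem_orientedPairs.1 he).2
  rw [h] at this
  exact lt_irrefl _ this

theorem swap_notMem_orientedPairs {U : Finset V} {e : V × V} (he : e ∈ orientedPairs U) :
    (e.2, e.1) ∉ orientedPairs U := by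
  intro h
  exact lt_asymm (mem_orientedPairs.1 he).2 (mem_orientedPairs.1 h).2

theorem card_filter_offDiag_le (U : Finset V) (P : V → V → Prop) [DecidableEq V]
    [∀ u v, Decidable (P u v)] (hP : ∀ u v, P u v → P v u) :
    {e ∈ U.offDiag | P e.1 e.2}.card ≤ 2 * {e ∈ orientedPairs U | P e.1 e.2}.card := by
  rw [two_mul]
  have : {e ∈ U.offDiag | P e.1 e.2} ⊆ {e ∈ orientedPairs U | P e.1 e.2} ∪
      {e ∈ orientedPairs U | P e.1 e.2}.image Prod.swap := by
    rintro ⟨u, v⟩ he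
    simp only [mem_filter, mem_offDiag] at he
    obtain ⟨⟨hu, hv, hne⟩, hp⟩ := he
    rcases lt_or_gt_of_ne (fun h => hne ((Fintype.equivFin V).injective h)) with h | h
    · exact mem_union_left _ (mem_filter.2 ⟨mem_orientedPairs.2 ⟨⟨hu, hv⟩, h⟩, hp⟩)
    · exact mem_union_right _ (mem_image.2
        ⟨(v, u), mem_filter.2 ⟨mem_orientedPairs.2 ⟨⟨hv, hu⟩, h⟩, hP _ _ hp⟩, rfl⟩)
  exact (card_le_card this).trans ((card_union_le _ _).trans
    (Nat.add_le_add_left card_image_le _))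

theorem card_mul_pred_le_orientedPairs (U : Finset V) :
    U.card * (U.card - 1) ≤ 2 * (orientedPairs U).card := by
  classical
  have := card_filter_offDiag_le U (fun _ _ => True) (fun _ _ _ => trivial)
  simpa [offDiag_card, Nat.mul_sub_one] using this

end OrientedPairs

/-! ### Lines and twins in sets of diameter two -/

section DiameterTwo

variable {V : Type*} [MetricSpace V] {G : SimpleGraph V}

/-- Two points are twins in `S` if all other points of `S` have the same distances to both. -/
def IsTwin (G : SimpleGraph V) (S : Finset V) (u t : V) : Prop :=
  t ∈ S ∧ t ≠ u ∧ ∀ z ∈ S, z ≠ u → z ≠ t → G.dist z u = G.dist z t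

/-- When `v` is adjacent to `u`, the distance from `u` to a third point z together with membership
of z in the line determines d(z,v): on the line exactly one of d(u,z), d(v,z) is 2, off it they
agree. -/
theorem IsInducedByGraph.isTwin_of_adj (h : IsInducedByGraph V G) {S : Finset V}
    (hS : ∀ u ∈ S, ∀ v ∈ S, G.dist u v ≤ 2) {u v v' : V} (hu : u ∈ S) (hv : v ∈ S) (hv' : v' ∈ S)
    (h1 : G.dist u v = 1) (h2 : G.dist u v' = 1) (hL : metricLine u v = metricLine u v')
    (hne : v ≠ v') : IsTwin G S v v' := by
  refine ⟨hv', hne.symm, fun z hz hzv hzv' => ?_⟩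
  have e : z ∈ metricLine u v ↔ z ∈ metricLine u v' := by rw [hL]
  rw [h.mem_line (ne_of_dist_pos (G := G) (by omega)),
    h.mem_line (ne_of_dist_pos (G := G) (by omega))] at e
  have b1 := hS u hu z hz
  have b2 := hS z hz v hv
  have b3 := hS z hz v' hv'
  have p1 := h.pos_of_ne hzv
  have p2 := h.pos_of_ne hzv'
  have c1 := G.dist_comm (u := u) (v := v)
  have c2 := G.dist_comm (u := u) (v := v')
  have c3 := G.dist_comm (u := v) (v := z)
  have c4 := G.dist_comm (u := v') (v := z)
  rcases eq_or_ne u z with rfl | huz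
  · omega
  · have p3 := h.pos_of_ne huz
    omega

theorem IsInducedByGraph.nonadjacent_same_line (h : IsInducedByGraph V G) {S : Finset V}
    (hS : ∀ u ∈ S, ∀ v ∈ S, G.dist u v ≤ 2) {a b a' b' : V} (ha : a ∈ S) (hb : b ∈ S)
    (ha' : a' ∈ S) (hb' : b' ∈ S) (hab : G.dist a b = 2) (hab' : G.dist a' b' = 2)
    (hL : metricLine a b = metricLine a' b') :
    (a = a' ∧ b = b') ∨ (a = b' ∧ b = a') ∨
      (G.dist a a' = 1 ∧ G.dist a b' = 1 ∧ G.dist b a' = 1 ∧ G.dist b b' = 1) := by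
  have hne : a ≠ b := ne_of_dist_pos (G := G) (by omega)
  have m1 : a' ∈ metricLine a b := by rw [hL]; simp [metricLine]
  have m2 : b' ∈ metricLine a b := by rw [hL]; simp [metricLine]
  rw [h.mem_line hne] at m1 m2
  have b1 := hS a ha a' ha'
  have b2 := hS a ha b' hb'
  have b3 := hS b hb a' ha'
  have b4 := hS b hb b' hb'
  have c1 := G.dist_comm (u := b) (v := a)
  have c2 := G.dist_comm (u := a') (v := b)
  have c3 := G.dist_comm (u := b') (v := b)
  rcases Nat.eq_zero_or_pos (G.dist a a') with z | z
  · have e := h.dist_eq_zero.1 z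
    subst e
    refine Or.inl ⟨rfl, h.dist_eq_zero.1 ?_⟩
    omega
  rcases Nat.eq_zero_or_pos (G.dist b a') with z' | z'
  · have e := h.dist_eq_zero.1 z'
    subst e
    refine Or.inr (Or.inl ⟨h.dist_eq_zero.1 ?_, rfl⟩)
    omega
  have t1 := h.triangle a' a b'
  have t2 := h.triangle a' b b'
  have c4 := G.dist_comm (u := a) (v := a')
  refine Or.inr (Or.inr ⟨?_, ?_, ?_, ?_⟩) <;> omega

/-- A nonadjacent pair one of whose points has a further twin is the only nonadjacent pair that
generates its line. -/
theorem IsInducedByGraph.nonadjacent_unique (h : IsInducedByGraph V G) {S : Finset V}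
    (hS : ∀ u ∈ S, ∀ v ∈ S, G.dist u v ≤ 2) {u v a b t : V} (hu : u ∈ S) (hv : v ∈ S)
    (ha : a ∈ S) (hb : b ∈ S) (huv : G.dist u v = 2) (hab : G.dist a b = 2)
    (hL : metricLine u v = metricLine a b) (ht : IsTwin G S u t) (htv : t ≠ v) :
    (u = a ∧ v = b) ∨ (u = b ∧ v = a) := by
  rcases h.nonadjacent_same_line hS hu hv ha hb huv hab hL with h1 | h1 | ⟨h1, h2, h3, h4⟩
  · exact Or.inl h1
  · exact Or.inr h1
  exfalso
  -- In the remaining case u, a, v, b form a 4-cycle. The twin `t` is adjacent to `a` and `b`, hence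
  -- on their line; but d(v,t) = 2 and d(u,t) is 1 or 2, so `t` is off the line of `u` and `v`.
  obtain ⟨htS, htu, htw⟩ := ht
  have au : a ≠ u := fun e => by subst e; simp at h1
  have bu : b ≠ u := fun e => by subst e; simp at h2
  have vu : v ≠ u := fun e => by subst e; simp at huv
  have c1 := G.dist_comm (u := u) (v := a)
  have c2 := G.dist_comm (u := u) (v := b)
  have c3 := G.dist_comm (u := a) (v := b)
  have at' : a ≠ t := fun e => by
    have := htw b hb bu (by rintro rfl; subst e; simp at hab)
    rw [← e] at this
    omega
  have bt : b ≠ t := fun e => by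
    have := htw a ha au at'
    rw [← e] at this
    omega
  have e1 := htw a ha au at'
  have e2 := htw b hb bu bt
  have e3 := htw v hv vu htv.symm
  have c4 := G.dist_comm (u := u) (v := v)
  have c5 := G.dist_comm (u := b) (v := t)
  have c6 := G.dist_comm (u := v) (v := t)
  have c7 := G.dist_comm (u := u) (v := t)
  have p := h.pos_of_ne htu
  have b1 := hS u hu t htS
  have m : t ∈ metricLine u v := by
    rw [hL, h.mem_line (ne_of_dist_pos (G := G) (by omega))]
    omega
  rw [h.mem_line (ne_of_dist_pos (G := G) (by omega))] at m
  omega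

variable [Fintype V]

/-- The first points of the pairs are mutually adjacent, so no three are collinear. -/
theorem IsInducedByGraph.card_nonadjacent_same_line (h : IsInducedByGraph V G) {S : Finset V}
    (hS : ∀ u ∈ S, ∀ v ∈ S, G.dist u v ≤ 2) {J : Finset (V × V)} {L : Set V}
    (hJ : ∀ e ∈ J, e.1 ∈ S ∧ e.2 ∈ S ∧ G.dist e.1 e.2 = 2 ∧ metricLine e.1 e.2 = L)
    (hor : ∀ e ∈ J, (e.2, e.1) ∉ J) : J.card * (J.card - 1) ≤ 2 * (metricLines V).ncard := by
  have key : ∀ e ∈ J, ∀ e' ∈ J, e ≠ e' → G.dist e.1 e'.1 = 1 := by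
    intro e he e' he' hne
    obtain ⟨h1, h2, h3, h4⟩ := hJ e he
    obtain ⟨h1', h2', h3', h4'⟩ := hJ e' he'
    rcases h.nonadjacent_same_line hS h1 h2 h1' h2' h3 h3' (h4.trans h4'.symm) with c | c | c
    · exact absurd (Prod.ext c.1 c.2) hne
    · refine absurd ?_ (hor e he)
      rw [c.1, c.2]
      exact he'
    · exact c.1
  have hne : ∀ e ∈ J, ∀ e' ∈ J, e ≠ e' → e.1 ≠ e'.1 := fun e he e' he' hne =>
    ne_of_dist_pos (G := G) (by have := key e he e' he' hne; omega)
  refine card_mul_pred_le_of_noncollinear J Prod.fst hne ?_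
  intro j hj l hl m hm hjl hmj hml hmem
  rw [h.mem_line (hne j hj l hl hjl)] at hmem
  have k1 := key j hj l hl hjl
  have k2 := key j hj m hm hmj.symm
  have k3 := key m hm l hl hml
  have k4 := key l hl m hm hml.symm
  have k5 := key l hl j hj hjl.symm
  omega

/-- Without twins, pairs on one line are disjoint, and any two of them induce a 4-cycle whose
diagonals have length 2. -/
theorem IsInducedByGraph.card_adjacent_same_line (h : IsInducedByGraph V G) {S : Finset V}
    (hS : ∀ u ∈ S, ∀ v ∈ S, G.dist u v ≤ 2) {J : Finset (V × V)} {L : Set V}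
    (hJ : ∀ e ∈ J, e.1 ∈ S ∧ e.2 ∈ S ∧ G.dist e.1 e.2 = 1 ∧ metricLine e.1 e.2 = L)
    (htw : ∀ e ∈ J, (∀ t, ¬ IsTwin G S e.1 t) ∧ ∀ t, ¬ IsTwin G S e.2 t)
    (hor : ∀ e ∈ J, (e.2, e.1) ∉ J) : J.card * (J.card - 1) ≤ 2 * (metricLines V).ncard := by
  classical
  have key : ∀ e ∈ J, ∀ e' ∈ J, e ≠ e' →
      (G.dist e.1 e'.1 = 1 ∧ G.dist e.1 e'.2 = 2 ∧ G.dist e.2 e'.1 = 2 ∧ G.dist e.2 e'.2 = 1) ∨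
      (G.dist e.1 e'.1 = 2 ∧ G.dist e.1 e'.2 = 1 ∧ G.dist e.2 e'.1 = 1 ∧ G.dist e.2 e'.2 = 2) := by
    intro e he e' he' hne
    obtain ⟨h1, h2, h3, h4⟩ := hJ e he
    obtain ⟨h1', h2', h3', h4'⟩ := hJ e' he'
    have hL := h4.trans h4'.symm
    have c := G.dist_comm (u := e.1) (v := e.2)
    have c' := G.dist_comm (u := e'.1) (v := e'.2)
    have n1 : e.1 ≠ e'.1 := fun q => by
      refine (htw e he).2 _ (h.isTwin_of_adj hS h1 h2 h2' h3 (q ▸ h3') (by rw [hL, q]) ?_)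
      exact fun q' => hne (Prod.ext q q')
    have n2 : e.2 ≠ e'.2 := fun q => by
      refine (htw e he).1 _ (h.isTwin_of_adj hS h2 h1 h1' (by omega) (by rw [q]; omega) ?_ n1)
      rw [h.metricLine_comm, hL, q, h.metricLine_comm]
    have n3 : e.1 ≠ e'.2 := fun q => by
      refine (htw e he).2 _ (h.isTwin_of_adj hS h1 h2 h1' h3 (by rw [q]; omega)
        (by rw [hL, q, h.metricLine_comm]) ?_)
      intro q'
      refine hor e he ?_
      rw [q, q']
      exact he'
    have n4 : e.2 ≠ e'.1 := fun q => by
      refine (htw e he).1 _ (h.isTwin_of_adj hS h2 h1 h2' (by omega) (by rw [q]; omega) ?_ n3)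
      rw [h.metricLine_comm, hL, q]
    have m1 : e'.1 ∈ metricLine e.1 e.2 := by rw [hL]; simp [metricLine]
    have m2 : e'.2 ∈ metricLine e.1 e.2 := by rw [hL]; simp [metricLine]
    have m3 : e.1 ∈ metricLine e'.1 e'.2 := by rw [← hL]; simp [metricLine]
    rw [h.mem_line (ne_of_dist_pos (G := G) (by omega))] at m1 m2 m3
    have b1 := hS _ h1 _ h1'
    have b2 := hS _ h1 _ h2'
    have b3 := hS _ h2 _ h1'
    have b4 := hS _ h2 _ h2'
    have p1 := h.pos_of_ne n1
    have p2 := h.pos_of_ne n2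
    have p3 := h.pos_of_ne n3
    have p4 := h.pos_of_ne n4
    rw [G.dist_comm (u := e'.1) (v := e.2), G.dist_comm (u := e.2) (v := e.1)] at m1
    rw [G.dist_comm (u := e'.2) (v := e.2), G.dist_comm (u := e.2) (v := e.1)] at m2
    rw [G.dist_comm (u := e'.1) (v := e.1), G.dist_comm (u := e'.2) (v := e.1),
      G.dist_comm (u := e'.2) (v := e'.1)] at m3
    omega
  -- The line of a diagonal contains all four points of the cycle. A third pair has complementary
  -- distances 1 and 2 to each end of that diagonal, so at most one of its points is on the line.
  refine card_mul_pred_le_of_incidence J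
    (fun e e' => if G.dist e.1 e'.1 = 2 then metricLine e.1 e'.1 else metricLine e.1 e'.2)
    (fun m L => m.1 ∈ L ∧ m.2 ∈ L) ?_ ?_ ?_
  · intro e he e' he' hne
    have k := key e he e' he' hne
    split_ifs with hd <;>
      exact metricLine_mem_metricLines (ne_of_dist_pos (G := G) (by omega))
  · intro e he e' he' hne
    have k := key e he e' he' hne
    obtain ⟨-, -, h3, -⟩ := hJ e he
    obtain ⟨-, -, h3', -⟩ := hJ e' he'
    have c1 := G.dist_comm (u := e.2) (v := e'.1)
    have c2 := G.dist_comm (u := e'.2) (v := e'.1)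
    split_ifs with hd <;>
      rw [h.mem_line (ne_of_dist_pos (G := G) (by omega)),
        h.mem_line (ne_of_dist_pos (G := G) (by omega)),
        h.mem_line (ne_of_dist_pos (G := G) (by omega)),
        h.mem_line (ne_of_dist_pos (G := G) (by omega))] <;>
      simp only [SimpleGraph.dist_self] <;> omega
  · intro e he e' he' hne m hm hme hme'
    have k := key e he e' he' hne
    have k1 := key e he m hm hme.symm
    have k2 := key m hm e' he' hme'
    have c1 := G.dist_comm (u := m.1) (v := e'.1)
    have c2 := G.dist_comm (u := m.1) (v := e'.2)
    have c3 := G.dist_comm (u := m.2) (v := e'.1)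
    have c4 := G.dist_comm (u := m.2) (v := e'.2)
    have c5 := G.dist_comm (u := e.1) (v := e'.1)
    have c6 := G.dist_comm (u := e.1) (v := e'.2)
    split_ifs with hd <;>
      rw [h.mem_line (ne_of_dist_pos (G := G) (by omega)),
        h.mem_line (ne_of_dist_pos (G := G) (by omega))] <;> omega

end DiameterTwo

/-! ### Counting points with and without twins -/

section DiameterTwoCounts

variable {V : Type*} [MetricSpace V] {G : SimpleGraph V} [Fintype V]

/-- There are few points without twins. -/
theorem IsInducedByGraph.card_twinless (h : IsInducedByGraph V G) {S U : Finset V} {κ : ℕ}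
    (hS : ∀ u ∈ S, ∀ v ∈ S, G.dist u v ≤ 2)
    (hκ : ∀ k : ℕ, k * (k - 1) ≤ 2 * (metricLines V).ncard → k ≤ κ) (hUS : U ⊆ S)
    (hU : ∀ u ∈ U, ∀ t, ¬ IsTwin G S u t) :
    U.card * (U.card - 1) ≤ 4 * (κ * (metricLines V).ncard) := by
  classical
  have part : ∀ i, 1 ≤ i → i ≤ 2 →
      {e ∈ orientedPairs U | G.dist e.1 e.2 = i}.card ≤ κ * (metricLines V).ncard := by
    intro i hi hi2
    refine card_le_mul_ncard_metricLines _ (fun e => metricLine e.1 e.2) κ ?_ ?_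
    · intro e he
      exact metricLine_mem_metricLines (ne_of_mem_orientedPairs (mem_filter.1 he).1)
    · intro t ht hte
      apply hκ
      rcases t.eq_empty_or_nonempty with rfl | ⟨e₀, he₀⟩
      · simp
      have ht' : ∀ e ∈ t, e ∈ orientedPairs U ∧ G.dist e.1 e.2 = i := fun e he =>
        mem_filter.1 (ht he)
      have hor : ∀ e ∈ t, (e.2, e.1) ∉ t := fun e he he' =>
        swap_notMem_orientedPairs (ht' e he).1 (ht' _ he').1
      have hmem : ∀ e ∈ t, e.1 ∈ U ∧ e.2 ∈ U := fun e he => (mem_orientedPairs.1 (ht' e he).1).1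
      have hJ : ∀ e ∈ t, e.1 ∈ S ∧ e.2 ∈ S ∧ G.dist e.1 e.2 = i ∧
          metricLine e.1 e.2 = metricLine e₀.1 e₀.2 := fun e he =>
        ⟨hUS (hmem e he).1, hUS (hmem e he).2, (ht' e he).2, hte e he e₀ he₀⟩
      obtain rfl | rfl : i = 1 ∨ i = 2 := by omega
      · exact h.card_adjacent_same_line hS hJ
          (fun e he => ⟨hU _ (hmem e he).1, hU _ (hmem e he).2⟩) hor
      · exact h.card_nonadjacent_same_line hS hJ hor
  have hsub : orientedPairs U ⊆ {e ∈ orientedPairs U | G.dist e.1 e.2 = 1} ∪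
      {e ∈ orientedPairs U | G.dist e.1 e.2 = 2} := by
    intro e he
    have hm := (mem_orientedPairs.1 he).1
    have := hS _ (hUS hm.1) _ (hUS hm.2)
    have := h.pos_of_ne (ne_of_mem_orientedPairs he)
    simp only [mem_union, mem_filter, he, true_and]
    omega
  have h1 := (card_le_card hsub).trans (card_union_le _ _)
  have h2 := part 1 le_rfl (by norm_num)
  have h3 := part 2 (by norm_num) le_rfl
  have h4 := card_mul_pred_le_orientedPairs U
  omega

/-- There are few equal or nonadjacent pairs of points that have twins. -/
theorem IsInducedByGraph.card_nonadjacent_of_twins (h : IsInducedByGraph V G) {S B : Finset V}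
    (hS : ∀ u ∈ S, ∀ v ∈ S, G.dist u v ≤ 2) (hBS : B ⊆ S)
    (hB : ∀ u ∈ B, ∃ t, IsTwin G S u t) :
    {e ∈ B ×ˢ B | G.dist e.1 e.2 ≠ 1}.card ≤ 2 * (metricLines V).ncard + 2 * B.card := by
  classical
  -- Good pairs are covered by `nonadjacent_unique`. In a bad pair the second point is the only twin
  -- of the first, so the first point determines the pair.
  let Good : Finset (V × V) :=
    {e ∈ B ×ˢ B | G.dist e.1 e.2 = 2 ∧ ∃ t, IsTwin G S e.1 t ∧ t ≠ e.2}
  let Bad : Finset (V × V) :=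
    {e ∈ B ×ˢ B | G.dist e.1 e.2 = 2 ∧ ∀ t, IsTwin G S e.1 t → t = e.2}
  have hgood : Good.card ≤ 2 * (metricLines V).ncard := by
    refine card_le_mul_ncard_metricLines _ (fun e => metricLine e.1 e.2) 2 ?_ ?_
    · intro e he
      have := (mem_filter.1 he).2.1
      exact metricLine_mem_metricLines (ne_of_dist_pos (G := G) (by omega))
    · intro T hT hte
      rcases T.eq_empty_or_nonempty with rfl | ⟨⟨u, v⟩, he⟩
      · simp
      refine (card_le_card (t := {(u, v), (v, u)}) ?_).trans card_le_two
      rintro ⟨a, b⟩ he'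
      have m := mem_filter.1 (hT he)
      have m' := mem_filter.1 (hT he')
      obtain ⟨t, ht, htv⟩ := m.2.2
      have mB := mem_product.1 m.1
      have mB' := mem_product.1 m'.1
      rcases h.nonadjacent_unique hS (hBS mB.1) (hBS mB.2) (hBS mB'.1) (hBS mB'.2) m.2.1 m'.2.1
        (hte _ he _ he') ht htv with ⟨e1, e2⟩ | ⟨e1, e2⟩
      · simp only at e1 e2
        simp [e1, e2]
      · simp only at e1 e2
        simp [e1, e2]
  have hbad : Bad.card ≤ B.card := by
    refine card_le_card_of_injOn Prod.fst ?_ ?_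
    · intro e he
      exact (mem_product.1 (mem_filter.1 he).1).1
    · rintro ⟨u, v⟩ he ⟨u', v'⟩ he' hee
      simp only at hee
      subst hee
      have m := mem_filter.1 he
      have m' := mem_filter.1 he'
      obtain ⟨t, ht⟩ := hB u (mem_product.1 m.1).1
      have e1 := m.2.2 t ht
      have e2 := m'.2.2 t ht
      simp only at e1 e2
      rw [← e1, ← e2]
  have hsub : {e ∈ B ×ˢ B | G.dist e.1 e.2 ≠ 1} ⊆ (Good ∪ Bad) ∪ B.diag := by
    rintro ⟨u, v⟩ he
    obtain ⟨hm, hd⟩ := mem_filter.1 he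
    have hm' := mem_product.1 hm
    simp only at hm' hd
    rcases eq_or_ne u v with rfl | hne
    · exact mem_union_right _ (by simpa using hm'.1)
    · have h1 := hS u (hBS hm'.1) v (hBS hm'.2)
      have h2 := h.pos_of_ne hne
      have h3 : G.dist u v = 2 := by omega
      refine mem_union_left _ ?_
      by_cases ht : ∃ t, IsTwin G S u t ∧ t ≠ v
      · exact mem_union_left _ (mem_filter.2 ⟨hm, h3, ht⟩)
      · push Not at ht
        exact mem_union_right _ (mem_filter.2 ⟨hm, h3, ht⟩)
  have h1 := card_le_card hsub
  have h2 := card_union_le (Good ∪ Bad) B.diag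
  have h3 := card_union_le Good Bad
  rw [diag_card] at h2
  omega

/-- The square of the number of adjacent pairs is bounded in terms of the number of lines and of the
number of other pairs. -/
theorem IsInducedByGraph.sq_card_adjacent_le (h : IsInducedByGraph V G) (B : Finset V) :
    {e ∈ B ×ˢ B | G.dist e.1 e.2 = 1}.card ^ 2 ≤
      (metricLines V).ncard * (2 * {e ∈ B ×ˢ B | G.dist e.1 e.2 ≠ 1}.card ^ 2) := by
  classical
  set A := {e ∈ B ×ˢ B | G.dist e.1 e.2 = 1} with hA
  set Q := {e ∈ B ×ˢ B | G.dist e.1 e.2 ≠ 1} with hQ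
  let T := (metricLines_finite V).toFinset
  have hT : T.card = (metricLines V).ncard :=
    (Set.ncard_eq_toFinset_card _ (metricLines_finite V)).symm
  have memA : ∀ e, e ∈ A ↔ (e.1 ∈ B ∧ e.2 ∈ B) ∧ G.dist e.1 e.2 = 1 := by
    intro e
    simp [hA]
  have memQ : ∀ e, e ∈ Q ↔ (e.1 ∈ B ∧ e.2 ∈ B) ∧ G.dist e.1 e.2 ≠ 1 := by
    intro e
    simp [hQ]
  have hf : ∀ e ∈ A, metricLine e.1 e.2 ∈ T := by
    intro e he
    have := ((memA e).1 he).2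
    simp only [T, Set.Finite.mem_toFinset]
    exact metricLine_mem_metricLines (ne_of_dist_pos (G := G) (by omega))
  set C := {p ∈ A ×ˢ A | metricLine p.1.1 p.1.2 = metricLine p.2.1 p.2.2} with hC
  have h0 : A.card ^ 2 ≤ (metricLines V).ncard * C.card := by
    rw [← hT]
    exact sq_card_le_mul_card_coincidences A (fun e => metricLine e.1 e.2) T hf
  let C₁ := {p ∈ C | (p.1.1, p.2.1) ∈ Q}
  let C₂ := {p ∈ C | (p.1.1, p.2.2) ∈ Q}
  have memC : ∀ p, p ∈ C ↔ (p.1 ∈ A ∧ p.2 ∈ A) ∧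
      metricLine p.1.1 p.1.2 = metricLine p.2.1 p.2.2 := by
    intro p
    simp [hC]
  -- As `u` is on the line of the adjacent points `u'` and `v'`, it cannot be at distance 1 from
  -- both.
  have hsub : C ⊆ C₁ ∪ C₂ := by
    rintro ⟨⟨u, v⟩, ⟨u', v'⟩⟩ hp
    have hp' := (memC _).1 hp
    have m1 := (memA _).1 hp'.1.1
    have m2 := (memA _).1 hp'.1.2
    have hL := hp'.2
    simp only at m1 m2 hL
    have hu : u ∈ metricLine u' v' := by
      rw [← hL]
      simp [metricLine]
    rw [h.mem_line (ne_of_dist_pos (G := G) (by omega))] at hu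
    have c1 := G.dist_comm (u := u) (v := u')
    have c2 := G.dist_comm (u := u) (v := v')
    have c3 := G.dist_comm (u := u') (v := v')
    simp only [mem_union, C₁, C₂, mem_filter, hp, memQ, m1.1, m2.1, true_and, and_self]
    omega
  -- Reversing the second pair keeps its line.
  have h21 : C₂.card ≤ C₁.card := by
    refine card_le_card_of_injOn (fun p => (p.1, p.2.swap)) ?_ ?_
    · rintro ⟨⟨u, v⟩, ⟨u', v'⟩⟩ hp
      have hp' := mem_filter.1 hp
      have hp'' := (memC _).1 hp'.1
      have m1 := (memA _).1 hp''.1.1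
      have m2 := (memA _).1 hp''.1.2
      have hL := hp''.2
      have hq := hp'.2
      simp only at m1 m2 hL hq
      refine mem_filter.2 ⟨(memC _).2 ⟨⟨hp''.1.1, (memA _).2 ⟨m2.1.symm, ?_⟩⟩, ?_⟩, hq⟩
      · rw [← m2.2]
        exact G.dist_comm
      · exact hL.trans (h.metricLine_comm _ _)
    · rintro ⟨e, e'⟩ _ ⟨g, g'⟩ _ he
      simp only [Prod.mk.injEq] at he
      exact Prod.ext he.1 (Prod.swap_injective he.2)
  have h1 : C₁.card ≤ Q.card * Q.card := by
    have hmap : ∀ p ∈ C₁, (p.1.1, p.2.1) ∈ Q := fun p hp => (mem_filter.1 hp).2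
    refine card_le_mul_card_image_of_maps_to hmap Q.card ?_
    rintro ⟨u, u'⟩ hu
    have huB := ((memQ _).1 hu).1
    simp only at huB
    let N : V → Finset V := fun w => {v ∈ B | G.dist w v = 1}
    have hN : ∀ w ∈ B, ∀ v ∈ N w, metricLine w v ∈ T := by
      intro w _ v hv
      have := (mem_filter.1 hv).2
      simp only [T, Set.Finite.mem_toFinset]
      exact metricLine_mem_metricLines (ne_of_dist_pos (G := G) (by omega))
    -- Two neighbours of `w` that generate the same line with it are equal or at distance 2, never
    -- adjacent.
    have hNQ : ∀ w ∈ B, {p ∈ N w ×ˢ N w | metricLine w p.1 = metricLine w p.2}.card ≤ Q.card := by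
      intro w hw
      refine card_le_card ?_
      rintro ⟨v, v'⟩ hp
      obtain ⟨hp1, hL⟩ := mem_filter.1 hp
      obtain ⟨hv, hv'⟩ := mem_product.1 hp1
      obtain ⟨b1, d1⟩ := mem_filter.1 hv
      obtain ⟨b2, d2⟩ := mem_filter.1 hv'
      simp only at b1 d1 b2 d2 hL
      refine (memQ _).2 ⟨⟨b1, b2⟩, ?_⟩
      have hm : v' ∈ metricLine w v := by
        rw [hL]
        simp [metricLine]
      rw [h.mem_line (ne_of_dist_pos (G := G) (by omega))] at hm
      have c1 := G.dist_comm (u := v) (v := v')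
      have c2 := G.dist_comm (u := v) (v := w)
      simp only
      omega
    refine le_trans ?_ (card_coincidences_le (N u) (N u') (fun v => metricLine u v)
      (fun v => metricLine u' v) T (hN u huB.1) (hN u' huB.2) (hNQ u huB.1) (hNQ u' huB.2))
    refine card_le_card_of_injOn (fun p => (p.1.2, p.2.2)) ?_ ?_
    · rintro ⟨⟨a, v⟩, ⟨a', v'⟩⟩ hp
      obtain ⟨hp1, hp2⟩ := mem_filter.1 hp
      have hp' := (memC _).1 (mem_filter.1 hp1).1
      have m1 := (memA _).1 hp'.1.1
      have m2 := (memA _).1 hp'.1.2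
      have hL := hp'.2
      simp only [Prod.mk.injEq] at hp2 m1 m2 hL
      obtain ⟨rfl, rfl⟩ := hp2
      simp only [coe_filter, mem_product, N, mem_filter, Set.mem_ofPred_eq]
      exact ⟨⟨⟨m1.1.2, m1.2⟩, m2.1.2, m2.2⟩, hL⟩
    · rintro ⟨⟨a, v⟩, ⟨a', v'⟩⟩ hp ⟨⟨b, w⟩, ⟨b', w'⟩⟩ hq he
      have hp2 := (mem_filter.1 hp).2
      have hq2 := (mem_filter.1 hq).2
      simp only [Prod.mk.injEq] at hp2 hq2 he ⊢
      exact ⟨⟨hp2.1.trans hq2.1.symm, he.1⟩, hp2.2.trans hq2.2.symm, he.2⟩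
  refine h0.trans (Nat.mul_le_mul_left _ ?_)
  have h2 := (card_le_card hsub).trans (card_union_le _ _)
  nlinarith

end DiameterTwoCounts

/-! ### Numerical bounds -/

section Asymptotics

variable {V : Type*} [MetricSpace V] {G : SimpleGraph V} [Fintype V]

/-- The integer ⌊√(2N)⌋ + 1 serves as κ, and 1.4143 is a rational just above √2. -/
theorem exists_pair_bound {N : ℕ} {Y : ℝ} (hN : (N : ℝ) ≤ Y ^ 4) :
    ∃ κ : ℕ, (∀ k : ℕ, k * (k - 1) ≤ 2 * N → k ≤ κ) ∧ (κ : ℝ) ≤ 1.4143 * Y ^ 2 + 1 := by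
  refine ⟨Nat.sqrt (2 * N) + 1, fun k hk => ?_, ?_⟩
  · by_contra hcon
    obtain ⟨m, rfl⟩ : ∃ m, k = Nat.sqrt (2 * N) + 2 + m := ⟨k - (Nat.sqrt (2 * N) + 2), by omega⟩
    have h1 := Nat.lt_succ_sqrt (2 * N)
    have h2 : (Nat.sqrt (2 * N) + 1) * (Nat.sqrt (2 * N) + 1) ≤
        (Nat.sqrt (2 * N) + 2 + m) * (Nat.sqrt (2 * N) + 2 + m - 1) :=
      Nat.mul_le_mul (by omega) (by omega)
    simp only [Nat.succ_eq_add_one] at h1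
    omega
  · have h1 : ((Nat.sqrt (2 * N) : ℕ) : ℝ) * (Nat.sqrt (2 * N) : ℕ) ≤ 2 * N := by
      exact_mod_cast Nat.sqrt_le (2 * N)
    push_cast
    have h2 : ((Nat.sqrt (2 * N) : ℕ) : ℝ) ≤ 1.4143 * Y ^ 2 := by
      refine abs_le_of_sq_le_sq' ?_ (by positivity) |>.2
      have : (0 : ℝ) ≤ Y ^ 4 := by positivity
      nlinarith
    linarith

theorem IsInducedByGraph.card_le_of_twins (h : IsInducedByGraph V G) {S B : Finset V} {Y : ℝ}
    (hY : 100 ≤ Y) (hN : ((metricLines V).ncard : ℝ) ≤ Y ^ 4)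
    (hS : ∀ u ∈ S, ∀ v ∈ S, G.dist u v ≤ 2) (hBS : B ⊆ S)
    (hB : ∀ u ∈ B, ∃ t, IsTwin G S u t) : (B.card : ℝ) ≤ 1.8 * Y ^ 3 := by
  classical
  have h1 := h.card_nonadjacent_of_twins hS hBS hB
  have h2 := h.sq_card_adjacent_le B
  have h3 := card_filter_add_card_filter_not (s := B ×ˢ B) (fun e => G.dist e.1 e.2 = 1)
  rw [card_product] at h3
  set a := {e ∈ B ×ˢ B | G.dist e.1 e.2 = 1}.card
  set q := {e ∈ B ×ˢ B | G.dist e.1 e.2 ≠ 1}.card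
  set N := (metricLines V).ncard
  set b := B.card
  have h1' : (q : ℝ) ≤ 2 * N + 2 * b := by exact_mod_cast h1
  have h2' : (a : ℝ) ^ 2 ≤ N * (2 * (q : ℝ) ^ 2) := by exact_mod_cast h2
  have h3' : (a : ℝ) + q = b * b := by exact_mod_cast h3
  have hq0 : (0 : ℝ) ≤ q := Nat.cast_nonneg q
  have ha : (a : ℝ) ≤ 1.4143 * Y ^ 2 * q := by
    refine abs_le_of_sq_le_sq' ?_ (by positivity) |>.2
    have e1 : (N : ℝ) * (2 * (q : ℝ) ^ 2) ≤ Y ^ 4 * (2 * (q : ℝ) ^ 2) := by gcongr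
    have e2 : (0 : ℝ) ≤ Y ^ 4 * (q : ℝ) ^ 2 := by positivity
    nlinarith
  have hb : (b : ℝ) * b ≤ (1 + 1.4143 * Y ^ 2) * (2 * Y ^ 4 + 2 * b) := by
    have : (1 + 1.4143 * Y ^ 2) * q ≤ (1 + 1.4143 * Y ^ 2) * (2 * Y ^ 4 + 2 * b) := by
      gcongr
      linarith
    linarith
  by_contra hcon
  push Not at hcon
  have p3 : 0 < Y ^ 3 := by positivity
  have e1 : 100 * Y ^ 2 ≤ Y ^ 3 := by nlinarith [sq_nonneg Y]
  have e2 : (10000 : ℝ) ≤ Y ^ 2 := by nlinarith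
  have e3 : (b : ℝ) * (b - 2 - 2.8286 * Y ^ 2) ≤ 2 * Y ^ 4 + 2.8286 * Y ^ 6 := by nlinarith
  -- For Y ≥ 100 the subtracted terms cost less than 0.03 Y^3, and 1.8 · 1.77 exceeds 2.8286.
  have e4 : 1.8 * Y ^ 3 * (1.77 * Y ^ 3) ≤ (b : ℝ) * (b - 2 - 2.8286 * Y ^ 2) := by
    apply mul_le_mul hcon.le _ (by positivity) (by positivity)
    nlinarith
  have e5 : 10000 * Y ^ 4 ≤ Y ^ 6 := by
    have : 0 ≤ Y ^ 4 := by positivity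
    nlinarith
  have p6 : 0 < Y ^ 6 := by positivity
  nlinarith

theorem IsInducedByGraph.card_le_of_twinless (h : IsInducedByGraph V G) {S U : Finset V} {Y : ℝ}
    (hY : 100 ≤ Y) (hN : ((metricLines V).ncard : ℝ) ≤ Y ^ 4)
    (hS : ∀ u ∈ S, ∀ v ∈ S, G.dist u v ≤ 2) (hUS : U ⊆ S)
    (hU : ∀ u ∈ U, ∀ t, ¬ IsTwin G S u t) : (U.card : ℝ) ≤ 2.5 * Y ^ 3 := by
  obtain ⟨κ, hκ, hκY⟩ := exists_pair_bound hN
  have h1 := h.card_twinless hS hκ hUS hU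
  rcases Nat.eq_zero_or_pos U.card with h0 | h0
  · rw [h0]
    push_cast
    positivity
  set N := (metricLines V).ncard
  have h2 : (U.card : ℝ) * (U.card - 1) ≤ 4 * (κ * N) := by
    have : ((U.card - 1 : ℕ) : ℝ) = (U.card : ℝ) - 1 := by
      rw [Nat.cast_sub h0]
      simp
    rw [← this]
    exact_mod_cast h1
  have h3 : (κ : ℝ) * N ≤ (1.4143 * Y ^ 2 + 1) * Y ^ 4 := by gcongr
  by_contra hcon
  push Not at hcon
  have e2 : (10000 : ℝ) ≤ Y ^ 2 := by nlinarith
  have e3 : (1000000 : ℝ) ≤ Y ^ 3 := by nlinarith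
  -- The product 2.5 · 2.49 exceeds the leading coefficient 4 · 1.4143 of the upper bound.
  have e4 : 2.5 * Y ^ 3 * (2.49 * Y ^ 3) ≤ (U.card : ℝ) * (U.card - 1) := by
    apply mul_le_mul hcon.le _ (by positivity) (by positivity)
    nlinarith
  have e5 : 10000 * Y ^ 4 ≤ Y ^ 6 := by
    have : 0 ≤ Y ^ 4 := by positivity
    nlinarith
  have p6 : 0 < Y ^ 6 := by positivity
  nlinarith

theorem IsInducedByGraph.card_le_of_dist_le_two (h : IsInducedByGraph V G) {S : Finset V} {Y : ℝ}
    (hY : 100 ≤ Y) (hN : ((metricLines V).ncard : ℝ) ≤ Y ^ 4)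
    (hS : ∀ u ∈ S, ∀ v ∈ S, G.dist u v ≤ 2) : (S.card : ℝ) ≤ 4.3 * Y ^ 3 := by
  classical
  have h1 := card_filter_add_card_filter_not (s := S) (fun u => ∃ t, IsTwin G S u t)
  have h2 := h.card_le_of_twins hY hN hS (filter_subset (fun u => ∃ t, IsTwin G S u t) S)
    (fun u hu => (mem_filter.1 hu).2)
  have h3 := h.card_le_of_twinless hY hN hS (filter_subset (fun u => ¬ ∃ t, IsTwin G S u t) S)
    (fun u hu t ht => (mem_filter.1 hu).2 ⟨t, ht⟩)
  rw [← h1]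
  push_cast
  linarith

/-- Some vertex has at least the average number of neighbours. -/
theorem IsInducedByGraph.exists_degree (h : IsInducedByGraph V G) :
    ∃ x : V, Fintype.card V * Fintype.card V ≤
      Fintype.card V * ({y | G.dist x y = 1} : Finset V).card +
      2 * {e ∈ orientedPairs (univ : Finset V) | 2 ≤ G.dist e.1 e.2}.card + Fintype.card V := by
  classical
  obtain ⟨x, -, hx⟩ := exists_max_image (univ : Finset V)
    (fun x => ({y | G.dist x y = 1} : Finset V).card)
    (@univ_nonempty _ _ h.1.nonempty)
  refine ⟨x, ?_⟩
  have h1 := card_filter_offDiag_le (univ : Finset V) (fun u v => 2 ≤ G.dist u v)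
    (fun u v huv => by rwa [G.dist_comm])
  have h2 : ({e : V × V | G.dist e.1 e.2 = 1} : Finset (V × V)).card ≤
      ({y | G.dist x y = 1} : Finset V).card * (univ : Finset V).card := by
    refine card_le_mul_card_image_of_maps_to (f := Prod.fst) (fun _ _ => mem_univ _) _ ?_
    intro u _
    refine le_trans ?_ (hx u (mem_univ u))
    refine card_le_card_of_injOn Prod.snd ?_ ?_
    · rintro ⟨a, b⟩ he
      simp only [coe_filter, mem_filter, mem_univ, true_and, Set.mem_ofPred_eq] at he ⊢
      rw [← he.2]
      exact he.1
    · rintro ⟨a, b⟩ he ⟨a', b'⟩ he' hb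
      simp only [coe_filter, mem_filter, mem_univ, true_and, Set.mem_ofPred_eq] at he he' hb
      rw [Prod.mk.injEq]
      exact ⟨he.2.trans he'.2.symm, hb⟩
  have hsub : (univ : Finset (V × V)) ⊆ ({e : V × V | G.dist e.1 e.2 = 1} : Finset (V × V)) ∪
      {e ∈ (univ : Finset V).offDiag | 2 ≤ G.dist e.1 e.2} ∪ (univ : Finset V).diag := by
    rintro ⟨a, b⟩ -
    simp only [mem_union, mem_filter, mem_univ, true_and, mem_offDiag, mem_diag]
    rcases eq_or_ne a b with rfl | hne
    · simp
    · have := h.pos_of_ne hne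
      simp only [hne, ne_eq, not_false_eq_true, true_and, or_false]
      omega
  have h3 := (card_le_card hsub).trans ((card_union_le _ _).trans
    (Nat.add_le_add_right (card_union_le _ _) _))
  rw [diag_card, card_univ, card_univ, Fintype.card_prod] at h3
  rw [card_univ, Nat.mul_comm] at h2
  omega

/-- The number of vertices is bounded in terms of the diameter and the number of lines. -/
theorem IsInducedByGraph.card_le (h : IsInducedByGraph V G) {D : ℕ} {Y : ℝ} (hD₁ : 1 ≤ D)
    (hD : ∀ u v, G.dist u v ≤ D) (hY : 100 ≤ Y) (hN : ((metricLines V).ncard : ℝ) ≤ Y ^ 4) :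
    (Fintype.card V : ℝ) ≤ 3.36 * D * Y ^ 3 := by
  classical
  have e2 : (10000 : ℝ) ≤ Y ^ 2 := by nlinarith
  have e3 : (1000000 : ℝ) ≤ Y ^ 3 := by nlinarith
  obtain h12 | rfl | h3 : D = 1 ∨ D = 2 ∨ 3 ≤ D := by omega
  · have hS : ∀ u ∈ (univ : Finset V), ∀ v ∈ (univ : Finset V), G.dist u v ≤ 2 := fun u _ v _ => by
      have := hD u v
      omega
    rcases subsingleton_or_nontrivial V with hV | hV
    · have : (Fintype.card V : ℝ) ≤ 1 := by exact_mod_cast Fintype.card_le_one_iff_subsingleton.2 hV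
      rw [h12]
      push_cast
      linarith
    -- In a complete graph any two points are twins.
    · have := h.card_le_of_twins (B := univ) hY hN hS subset_rfl (fun u _ => by
        obtain ⟨t, ht⟩ := exists_ne u
        refine ⟨t, mem_univ t, ht, fun z _ h1 h2 => ?_⟩
        have := h.pos_of_ne h1
        have := h.pos_of_ne h2
        have := hD z u
        have := hD z t
        omega)
      rw [h12, ← card_univ]
      push_cast
      linarith
  · have := h.card_le_of_dist_le_two (S := univ) hY hN (fun u _ v _ => hD u v)
    rw [← card_univ]
    push_cast
    linarith
  · obtain ⟨x, hx⟩ := h.exists_degree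
    obtain ⟨κ, hκ, hκY⟩ := exists_pair_bound hN
    have hE := h.card_long_pairs (E := {e ∈ orientedPairs (univ : Finset V) | 2 ≤ G.dist e.1 e.2})
      hD hκ (fun e he => (mem_filter.1 he).2) (fun e he he' =>
        swap_notMem_orientedPairs (mem_filter.1 he).1 (mem_filter.1 he').1)
    have hs := h.card_le_of_dist_le_two (S := {y | G.dist x y = 1}) hY hN (fun u hu v hv => by
      have h1 := (mem_filter.1 hu).2
      have h2 := (mem_filter.1 hv).2
      have := h.triangle u x v
      rw [G.dist_comm (u := u) (v := x)] at this
      omega)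
    set n := Fintype.card V
    set N := (metricLines V).ncard
    set s := ({y | G.dist x y = 1} : Finset V).card
    set c := {e ∈ orientedPairs (univ : Finset V) | 2 ≤ G.dist e.1 e.2}.card
    have hx' : (n : ℝ) * n ≤ n * s + 2 * c + n := by exact_mod_cast hx
    have hE' : (c : ℝ) ≤ D * (κ * (2 * D) * N) := by exact_mod_cast hE
    have hn0 : (0 : ℝ) ≤ n := Nat.cast_nonneg n
    have hD0 : (3 : ℝ) ≤ D := by exact_mod_cast h3
    -- The threshold balances the cases. Many long pairs suffice as 2 · 1.4144 / 0.275 < 3.36²;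
    -- otherwise s + 1 ≥ (1 - 2 · 0.275) n, and 4.3 / 0.45 < 3 · 3.36 suffices because D ≥ 3.
    rcases le_or_gt (0.275 * (n : ℝ) ^ 2) (c : ℝ) with hc | hc
    · have h4 : (κ : ℝ) * N ≤ (1.4143 * Y ^ 2 + 1) * Y ^ 4 := by gcongr
      have h5 : 0.275 * (n : ℝ) ^ 2 ≤ 2 * (D : ℝ) ^ 2 * ((1.4143 * Y ^ 2 + 1) * Y ^ 4) := by
        calc 0.275 * (n : ℝ) ^ 2 ≤ D * (κ * (2 * D) * N) := hc.trans hE'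
          _ = 2 * (D : ℝ) ^ 2 * (κ * N) := by ring
          _ ≤ _ := by gcongr
      have h6 : (1.4143 * Y ^ 2 + 1) * Y ^ 4 ≤ 1.4144 * Y ^ 6 := by
        have : 0 ≤ Y ^ 4 := by positivity
        nlinarith
      have h7 : 2 * (D : ℝ) ^ 2 * ((1.4143 * Y ^ 2 + 1) * Y ^ 4) ≤
          2 * (D : ℝ) ^ 2 * (1.4144 * Y ^ 6) := by gcongr
      refine abs_le_of_sq_le_sq' ?_ (by positivity) |>.2
      have : 0 ≤ (D : ℝ) ^ 2 * Y ^ 6 := by positivity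
      nlinarith
    · have h4 : (n : ℝ) * (0.45 * n) ≤ n * (s + 1) := by nlinarith
      have h5 : 0.45 * (n : ℝ) ≤ s + 1 := by
        rcases eq_or_lt_of_le hn0 with h0 | h0
        · rw [← h0]
          have : (0 : ℝ) ≤ s := Nat.cast_nonneg s
          linarith
        · exact le_of_mul_le_mul_left h4 h0
      have h6 : 3 * Y ^ 3 ≤ D * Y ^ 3 := by gcongr
      nlinarith

end Asymptotics

end LineCounting

/-! ### Conclusion -/

theorem theorem7p4 :
    ∀ ε : ℝ, 0 < ε → ∃ K : ℝ, ∀ n D : ℕ, 1 ≤ D → K ≤ (n : ℝ) / (D : ℝ) →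
      ∀ (V : Type*) [Fintype V] [MetricSpace V] (G : SimpleGraph V),
        Fintype.card V = n → IsInducedByGraph V G → G.ediam ≤ (D : ℕ∞) →
          ((2 : ℝ) ^ (-(7 / 3) : ℝ) - ε) * ((n : ℝ) / (D : ℝ)) ^ (4 / 3 : ℝ)
            ≤ ((metricLines V).ncard : ℝ) := by
  intro ε hε
  -- This exceeds 3.36 · 100^3, which forces N^(1/4) ≥ 100. It does not depend on ε: the bound holds
  -- with 2^(-7/3) itself, and ε is dropped at the end.
  refine ⟨3360001, ?_⟩
  intro n D hD₁ hK V _ _ G hn h hdiam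
  have hD : ∀ u v, G.dist u v ≤ D := by
    intro u v
    have h1 : G.edist u v ≤ D := SimpleGraph.edist_le_ediam.trans hdiam
    rw [← (h.1 u v).coe_dist_eq_edist] at h1
    exact_mod_cast h1
  set N : ℝ := ((metricLines V).ncard : ℝ)
  have hN0 : 0 ≤ N := Nat.cast_nonneg _
  have hD0 : (0 : ℝ) < D := by exact_mod_cast hD₁
  set m : ℝ := (n : ℝ) / D
  have bound : ∀ Y : ℝ, 100 ≤ Y → N ≤ Y ^ 4 → m ≤ 3.36 * Y ^ 3 := by
    intro Y hY hNY
    have h1 := h.card_le hD₁ hD hY hNY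
    rw [hn] at h1
    rw [div_le_iff₀ hD0]
    linarith
  have hm0 : 0 ≤ m := by linarith
  have hroot : (N ^ (1 / 4 : ℝ)) ^ 4 = N := by
    rw [← Real.rpow_natCast, ← Real.rpow_mul hN0]
    norm_num
  have hroot100 : 100 ≤ N ^ (1 / 4 : ℝ) := by
    by_contra hcon
    push Not at hcon
    have h1 : N ≤ 100 ^ 4 := by
      rw [← hroot]
      gcongr
    have := bound 100 le_rfl h1
    norm_num at this
    linarith
  have h2 : m ≤ 2 ^ (7 / 4 : ℝ) * N ^ (3 / 4 : ℝ) := by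
    have h1 := bound _ hroot100 hroot.ge
    have h3 : (N ^ (1 / 4 : ℝ)) ^ 3 = N ^ (3 / 4 : ℝ) := by
      rw [← Real.rpow_natCast, ← Real.rpow_mul hN0]
      norm_num
    rw [h3] at h1
    refine h1.trans ?_
    gcongr
    -- The comparison is 3.36^4 ≤ 2^7 = 128.
    refine le_of_pow_le_pow_left₀ (n := 4) (by norm_num) (by positivity) ?_
    rw [← Real.rpow_natCast (2 ^ (7 / 4 : ℝ)), ← Real.rpow_mul (by norm_num)]
    norm_num
  have h3 : m ^ (4 / 3 : ℝ) ≤ 2 ^ (7 / 3 : ℝ) * N := by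
    calc m ^ (4 / 3 : ℝ) ≤ (2 ^ (7 / 4 : ℝ) * N ^ (3 / 4 : ℝ)) ^ (4 / 3 : ℝ) := by gcongr
      _ = 2 ^ (7 / 3 : ℝ) * N := by
        rw [Real.mul_rpow (by positivity) (by positivity), ← Real.rpow_mul (by norm_num),
          ← Real.rpow_mul hN0]
        norm_num
  have h4 : (2 : ℝ) ^ (-(7 / 3) : ℝ) * 2 ^ (7 / 3 : ℝ) = 1 := by
    rw [← Real.rpow_add (by norm_num)]
    norm_num
  have hm1 : 0 ≤ m ^ (4 / 3 : ℝ) := by positivity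
  calc ((2 : ℝ) ^ (-(7 / 3) : ℝ) - ε) * m ^ (4 / 3 : ℝ)
      ≤ (2 : ℝ) ^ (-(7 / 3) : ℝ) * m ^ (4 / 3 : ℝ) := by nlinarith
    _ ≤ (2 : ℝ) ^ (-(7 / 3) : ℝ) * (2 ^ (7 / 3 : ℝ) * N) := by gcongr
    _ = N := by rw [← mul_assoc, h4, one_mul]
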